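/- Conventions. In dimension two, a Lorentzian metric has signature $(1,1)$; a vector $X$ is called spacelike if $g(X,X)<0$ and timelike if $g(X,X)>0$. Minkowski space $\mathbb R^{1,2}$ has signature $(+,-,-)$, and $F$ denotes its bundle of (oriented) orthonormal frames $(e_1,e_2,e_3)$, $\langle e_1,e_1\rangle=1$, $\langle e_2,e_2\rangle=\langle e_3,e_3\rangle=-1$, with the forms $\omega^i,\omega^i_j$ given by $d\rho=e_i\omega^i$, $de_j=e_i\omega^i_j$ ($\rho$ the base point). For a Lorentzian surface $(M,g)$ and a local orthonormal coframing, $g=(\eta^1)^2-(\eta^2)^2$, the connection form $\eta^1_2=\eta^2_1$ and the Gauss curvature $K$ are determined by $d\eta^1=-\eta^1_2\wedge\eta^2$, $d\eta^2=-\eta^1_2\wedge\eta^1$, $d\eta^1_2=-K\,\eta^1\wedge\eta^2$. The isometric embedding system of $g$ into $\mathbb R^{1,2}$ is the Pfaffian system $\mathcal I$ on $M\times F$ (locally in $M$) generated by $$\theta_0=\omega^3,\quad \theta_1=\omega^1-\eta^1,\quad \theta_2=\omega^2-\eta^2,\quad \theta_3=\omega^1_2-\eta^1_2 .$$ The metric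 is *elliptic* if $K>0$. Then, with $k=\sqrt K$, the singular systems of $\mathcal I$ are the complex Pfaffian system $$W=\{\theta_0,\theta_1,\theta_2,\theta_3,\ \omega^3_1-\mathrm i k\,\eta^2,\ \omega^3_2+\mathrm i k\,\eta^1\}$$ and its complex conjugate $\overline W$. The elliptic metric $g$ is *Darboux integrable* if, near every point, $W,\overline W$ are a Darboux pair: writing $V^\infty$ for the final element of the derived flag of $V$, (a) $W+\overline W{}^\infty$ and $\overline W+W^\infty$ are the whole complexified cotangent bundle; (b) $W^\infty\cap\overline W{}^\infty=0$; (c) $d\omega\in\Omega^2(W)+\Omega^2(\overline W)$ for every section $\omega$ of $W\cap\overline W$. (This does not depend on the coframing.) Theorem. Let $g$ be a smooth elliptic Darboux integrable Lorentzian metric on a smooth surface $M$ that admits a Killing field which is spacelike at every point. Then every point of $M$ has a neighbourhood with smooth coordinates $(u,v)$, $u>0$, in which one of the following holds: 1. $g=r\,\bigl(\cosh^4 u\,du^2-\sinh^2 u\,dv^2\bigr)$ for some constant $r>0$, and $K=r^{-1}\operatorname{sech}^4u$; 2. $g=r\,\bigl(\sinh^4 u\,du^2-\cosh^2 u\,dv^2\bigr)$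 for some constant $r>0$, and $K=r^{-1}\operatorname{csch}^4u$; 3. $g=u^2\,(du^2-dv^2)$, and $K=u^{-4}$. -/

import Mathlib

open scoped Manifold ContDiff

namespace IsoEmbed

/-! ### One-forms and two-forms on a normed space -/

section Forms

variable {E : Type*} [NormedAddCommGroup E] [NormedSpace ℝ E]

/-- Exterior derivative of a (real- or complex-valued) 1-form `α`:
`dα (v, w) = (D_v α) w - (D_w α) v`. -/
noncomputable def extD {A : Type*} [NormedAddCommGroup A] [NormedSpace ℝ A]
    (α : E → E →L[ℝ] A) (z : E) : E → E → A :=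
  fun v w => fderiv ℝ α z v w - fderiv ℝ α z w v

/-- Wedge product of two covectors, as an alternating bilinear function. -/
noncomputable def wedge {A : Type*} [NormedRing A] [NormedAlgebra ℝ A]
    (β γ : E →L[ℝ] A) : E → E → A :=
  fun v w => β v * γ w - β w * γ v

end Forms

/-! ### Complexified Pfaffian systems on an embedded submanifold

`N` is a closed embedded submanifold of an open set `Ω` of a vector space `E`, with tangent spaces
`T z ⊆ E` for `z ∈ N`.  A complex-valued 1-form on `N` is represented by a smooth `E`-1-form on `Ω`;
only its values on tangent vectors of `N` matter.  A Pfaffian system is represented by the set of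
all its smooth sections. -/

section Pfaffian

variable {E : Type*} [NormedAddCommGroup E] [NormedSpace ℝ E]

/-- The smooth sections of the sub-bundle of `T*N ⊗ ℂ` with fibres `V z |_{T z}`. -/
def pfaffSections (Ω N : Set E) (T : E → Submodule ℝ E)
    (V : E → Submodule ℂ (E →L[ℝ] ℂ)) : Set (E → E →L[ℝ] ℂ) :=
  {α | ContDiffOn ℝ ∞ α Ω ∧ ∀ z ∈ N, ∃ β ∈ V z, ∀ v ∈ T z, α z v = β v}

/-- The derived system: those `α` in the system with `dα ≡ 0` modulo the system, that is, with
`dα` (restricted to `N`) in the algebraic ideal generated by the system. -/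
def derivedSystem (N : Set E) (T : E → Submodule ℝ E)
    (S : Set (E → E →L[ℝ] ℂ)) : Set (E → E →L[ℝ] ℂ) :=
  {α | α ∈ S ∧ ∀ z ∈ N,
    ∃ Ψ ∈ Submodule.span ℂ {Φ : E → E → ℂ | ∃ β ∈ S, ∃ γ : E →L[ℝ] ℂ, Φ = wedge (β z) γ},
      ∀ v ∈ T z, ∀ w ∈ T z, extD α z v w = Ψ v w}

/-- The final element of the derived flag. -/
def finalDerived (N : Set E) (T : E → Submodule ℝ E)
    (S : Set (E → E →L[ℝ] ℂ)) : Set (E → E →L[ℝ] ℂ) :=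
  ⋂ k : ℕ, (derivedSystem N T)^[k] S

/-- `Λ²` of the fibre at `z` of the system with sections `S`. -/
def lambdaTwo (S : Set (E → E →L[ℝ] ℂ)) (z : E) : Submodule ℂ (E → E → ℂ) :=
  Submodule.span ℂ {Φ | ∃ β ∈ S, ∃ γ ∈ S, Φ = wedge (β z) (γ z)}

/-- The systems with sections `S₁`, `S₂` form a Darboux pair on `N`:
(a) `V₁ + V₂^∞ = T*N` and `V₂ + V₁^∞ = T*N`; (b) `V₁^∞ ∩ V₂^∞ = 0`;
(c) `dτ ∈ Λ²V₁ + Λ²V₂` for all sections `τ` of `V₁ ∩ V₂` (everything complexified). -/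
structure IsDarbouxPair (N : Set E) (T : E → Submodule ℝ E)
    (S₁ S₂ : Set (E → E →L[ℝ] ℂ)) : Prop where
  spans₁ : ∀ z ∈ N, ∀ γ : E →L[ℝ] ℂ, ∃ α ∈ S₁, ∃ β ∈ finalDerived N T S₂,
    ∀ v ∈ T z, γ v = α z v + β z v
  spans₂ : ∀ z ∈ N, ∀ γ : E →L[ℝ] ℂ, ∃ α ∈ S₂, ∃ β ∈ finalDerived N T S₁,
    ∀ v ∈ T z, γ v = α z v + β z v
  inter : ∀ z ∈ N, ∀ α ∈ finalDerived N T S₁, ∀ β ∈ finalDerived N T S₂,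
    (∀ v ∈ T z, α z v = β z v) → ∀ v ∈ T z, α z v = 0
  decomp : ∀ τ ∈ S₁ ∩ S₂, ∀ z ∈ N, ∃ Ψ ∈ lambdaTwo S₁ z ⊔ lambdaTwo S₂ z,
    ∀ v ∈ T z, ∀ w ∈ T z, extD τ z v w = Ψ v w

end Pfaffian

/-! ### Local Lorentzian geometry in the coordinate plane -/

/-- The coordinate plane. -/
abbrev Plane := EuclideanSpace ℝ (Fin 2)

/-- An orthonormal coframing `η₁, η₂` (timelike, spacelike) on an open set `U` of the plane for the
Lorentzian metric `η₁² - η₂²`, with its connection form `η₁₂ = η¹₂ = η²₁` and Gauss curvature `K`,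
which are the unique ones satisfying the structure equations. -/
structure CartanFrame (U : Set Plane) where
  η₁ : Plane → Plane →L[ℝ] ℝ
  η₂ : Plane → Plane →L[ℝ] ℝ
  η₁₂ : Plane → Plane →L[ℝ] ℝ
  K : Plane → ℝ
  smooth_η₁ : ContDiffOn ℝ ∞ η₁ U
  smooth_η₂ : ContDiffOn ℝ ∞ η₂ U
  smooth_η₁₂ : ContDiffOn ℝ ∞ η₁₂ U
  smooth_K : ContDiffOn ℝ ∞ K U
  d_η₁ : ∀ y ∈ U, ∀ v w, extD η₁ y v w = -wedge (η₁₂ y) (η₂ y) v w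
  d_η₂ : ∀ y ∈ U, ∀ v w, extD η₂ y v w = -wedge (η₁₂ y) (η₁ y) v w
  d_η₁₂ : ∀ y ∈ U, ∀ v w, extD η₁₂ y v w = -(K y * wedge (η₁ y) (η₂ y) v w)

/-! ### The orthonormal frame bundle of Minkowski space `ℝ^{1,2}` -/

/-- Signature `(+,-,-)`. -/
def sgn : Fin 3 → ℝ := ![1, -1, -1]

/-- The Minkowski inner product with a fixed vector, as a covector. -/
noncomputable def mink (v : Fin 3 → ℝ) : (Fin 3 → ℝ) →L[ℝ] ℝ :=
  ∑ i : Fin 3, (sgn i * v i) • ContinuousLinearMap.proj (R := ℝ) (φ := fun _ : Fin 3 => ℝ) i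

/-- The vector space containing `M × F`: triples `(y, ρ, e)` of a point `y` of the coordinate plane,
a base point `ρ` in `ℝ^{1,2}` and three vectors `e 0, e 1, e 2` of `ℝ^{1,2}`. -/
abbrev Amb := Plane × (Fin 3 → ℝ) × (Fin 3 → Fin 3 → ℝ)

/-- `U × F` inside `Amb`, where `F` is the (oriented) orthonormal frame bundle of `ℝ^{1,2}`:
`⟨e_i, e_i⟩ = 1, -1, -1`, `⟨e_i, e_j⟩ = 0` for `i ≠ j`, with structure group `SO(1,2)`. -/
def frameDomain (U : Set Plane) : Set Amb :=
  {z | z.1 ∈ U ∧ (∀ i j, mink (z.2.2 i) (z.2.2 j) = if i = j then sgn i else 0) ∧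
    (Matrix.of z.2.2).det = 1}

/-- The tangent space of `U × F` at `z`: the kernel of the linearised orthonormality relations. -/
noncomputable def frameTangent (z : Amb) : Submodule ℝ Amb where
  carrier := {v | ∀ i j, mink (z.2.2 j) (v.2.2 i) + mink (z.2.2 i) (v.2.2 j) = 0}
  add_mem' := by
    intro a b ha hb i j
    have h1 := ha i j
    have h2 := hb i j
    simp only [Prod.snd_add, Pi.add_apply, map_add] at *
    linarith
  zero_mem' := by
    intro i j
    simp
  smul_mem' := by
    intro c a ha i j
    have h1 := ha i j
    simp only [Prod.smul_snd, Pi.smul_apply, map_smul, smul_eq_mul] at *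
    rw [← mul_add, h1, mul_zero]

/-- The canonical forms: `dρ = e_i ω^i`. -/
noncomputable def canon (i : Fin 3) (z : Amb) : Amb →L[ℝ] ℝ :=
  sgn i • (mink (z.2.2 i) ∘L ContinuousLinearMap.fst ℝ _ _ ∘L ContinuousLinearMap.snd ℝ _ _)

/-- The connection forms: `de_j = e_i ω^i_j`. -/
noncomputable def conn (i j : Fin 3) (z : Amb) : Amb →L[ℝ] ℝ :=
  sgn i • (mink (z.2.2 i) ∘L ContinuousLinearMap.proj (R := ℝ) (φ := fun _ : Fin 3 => Fin 3 → ℝ) j ∘L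
    ContinuousLinearMap.snd ℝ _ _ ∘L ContinuousLinearMap.snd ℝ _ _)

/-- Pull-back to `Amb` of a 1-form on the plane. -/
noncomputable def pullPlane (η : Plane → Plane →L[ℝ] ℝ) (z : Amb) : Amb →L[ℝ] ℝ :=
  η z.1 ∘L ContinuousLinearMap.fst ℝ _ _

/-- A real covector viewed as a complex-valued one. -/
noncomputable def toC {E : Type*} [NormedAddCommGroup E] [NormedSpace ℝ E]
    (β : E →L[ℝ] ℝ) : E →L[ℝ] ℂ :=
  Complex.ofRealCLM ∘L β

/-! ### The isometric embedding system -/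

namespace CartanFrame

variable {U : Set Plane} (c : CartanFrame U)

/-- Generators of the isometric embedding system on `U × F` (the system on the product of the frame
bundles, pulled back by the orthonormal framing): `θ₀ = ω³`, `θ₁ = ω¹ - η¹`, `θ₂ = ω² - η²`,
`θ₃ = ω¹₂ - η¹₂`. Indices of frame vectors are shifted to `0, 1, 2`. -/
noncomputable def θ : Fin 4 → Amb → Amb →L[ℝ] ℝ
  | 0 => canon 2
  | 1 => fun z => canon 0 z - pullPlane c.η₁ z
  | 2 => fun z => canon 1 z - pullPlane c.η₂ z
  | 3 => fun z => conn 0 1 z - pullPlane c.η₁₂ z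

/-- The fibres of the complexified Pfaffian system spanned by `θ₀, θ₁, θ₂, θ₃` and
`ω³₁ - μ η²`, `ω³₂ + μ η¹`, for a complex-valued function `μ`.  If `μ² = -K`, the wedge product of
the last two is the decomposable combination `Ω₁ + μ Ω₀` of
`Ω₀ = ω³₁ ∧ η¹ + ω³₂ ∧ η²` and `Ω₁ = ω³₁ ∧ ω³₂ - K η¹ ∧ η²`, the algebraic generators of degree two
(`dθ₀ ≡ -Ω₀`, `dθ₃ ≡ -Ω₁` modulo the `θ`s). -/
noncomputable def singularFibre (μ : Plane → ℂ) (z : Amb) : Submodule ℂ (Amb →L[ℝ] ℂ) :=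
  Submodule.span ℂ (Set.range (fun a => toC (c.θ a z)) ∪
    {toC (conn 2 0 z) - μ z.1 • toC (pullPlane c.η₂ z),
     toC (conn 2 1 z) + μ z.1 • toC (pullPlane c.η₁ z)})

/-- The sections of the system with fibres `singularFibre μ`, on `U × F`. -/
noncomputable def singularSystem (μ : Plane → ℂ) : Set (Amb → Amb →L[ℝ] ℂ) :=
  pfaffSections {z : Amb | z.1 ∈ U} (frameDomain U) frameTangent (c.singularFibre μ)

/-- The isometric embedding system into `ℝ^{1,2}` of the metric `η₁² - η₂²` is elliptic (`K > 0`)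
and Darboux integrable: its singular systems, given by `μ = i √K` and the complex conjugate
`μ = -i √K`, are a Darboux pair. -/
def IsEllipticDarbouxIntegrable : Prop :=
  (∀ y ∈ U, 0 < c.K y) ∧
  IsDarbouxPair (frameDomain U) frameTangent
    (c.singularSystem fun y => Complex.I * (Real.sqrt (c.K y) : ℂ))
    (c.singularSystem fun y => -(Complex.I * (Real.sqrt (c.K y) : ℂ)))

end CartanFrame

/-! ### Lorentzian surfaces -/

/-- A smooth Lorentzian metric, of signature `(1,1)`, on a surface `M`. -/
structure LorentzMetric (M : Type*) [TopologicalSpace M] [ChartedSpace Plane M]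
    [IsManifold (𝓡 2) ∞ M] where
  val (x : M) : TangentSpace (𝓡 2) x →L[ℝ] TangentSpace (𝓡 2) x →L[ℝ] ℝ
  symm (x : M) (v w : TangentSpace (𝓡 2) x) : val x v w = val x w v
  exists_timelike (x : M) : ∃ v : TangentSpace (𝓡 2) x, 0 < val x v v
  exists_spacelike (x : M) : ∃ v : TangentSpace (𝓡 2) x, val x v v < 0
  contMDiff : ContMDiff (𝓡 2) ((𝓡 2).prod 𝓘(ℝ, Plane →L[ℝ] Plane →L[ℝ] ℝ)) ∞
    (fun x => Bundle.TotalSpace.mk' (Plane →L[ℝ] Plane →L[ℝ] ℝ)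
      (E := fun x : M => TangentSpace (𝓡 2) x →L[ℝ] TangentSpace (𝓡 2) x →L[ℝ] ℝ) x (val x))

namespace LorentzMetric

variable {M : Type*} [TopologicalSpace M] [ChartedSpace Plane M] [IsManifold (𝓡 2) ∞ M]
  (g : LorentzMetric M)

/-- The metric in the chart `φ`: the bilinear form on coordinate vectors at `y ∈ φ.target`. -/
noncomputable def coord (φ : OpenPartialHomeomorph M Plane) (y a b : Plane) : ℝ :=
  g.val (φ.symm y) (mfderiv (𝓡 2) (𝓡 2) φ.symm y a) (mfderiv (𝓡 2) (𝓡 2) φ.symm y b)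

/-- The coframing `c` on the coordinate domain of `φ` is orthonormal for `g`:
`g = η₁² - η₂²`. -/
def IsOrthonormal (φ : OpenPartialHomeomorph M Plane) (c : CartanFrame φ.target) : Prop :=
  ∀ y ∈ φ.target, ∀ a b, g.coord φ y a b = c.η₁ y a * c.η₁ y b - c.η₂ y a * c.η₂ y b

/-- The Gauss curvature of `g` is the function `κ` of the coordinates given by `φ`. -/
def HasGaussCurvature (φ : OpenPartialHomeomorph M Plane) (κ : Plane → ℝ) : Prop :=
  ∃ c : CartanFrame φ.target, g.IsOrthonormal φ c ∧ ∀ y ∈ φ.target, c.K y = κ y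

/-- In the coordinates `u = y 0`, `v = y 1` given by `φ`, the metric is
`A(u) du² - B(u) dv²`. -/
def HasDiagonalForm (φ : OpenPartialHomeomorph M Plane) (A B : ℝ → ℝ) : Prop :=
  ∀ y ∈ φ.target, ∀ a b, g.coord φ y a b = A (y 0) * (a 0 * b 0) - B (y 0) * (a 1 * b 1)

/-- `g` is elliptic and Darboux integrable with respect to embedding into `ℝ^{1,2}`: near every
point, its isometric embedding system, written with the help of some local coordinates and some
local orthonormal framing, is so.  (The condition does not depend on these choices.) -/
def IsEllipticDarbouxIntegrable : Prop :=
  ∀ p : M, ∃ φ ∈ IsManifold.maximalAtlas (𝓡 2) ∞ M, p ∈ φ.source ∧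
    ∃ c : CartanFrame φ.target, g.IsOrthonormal φ c ∧ c.IsEllipticDarbouxIntegrable

/-- The components in the chart `φ` of a vector field `X`. -/
noncomputable def coordField (X : (x : M) → TangentSpace (𝓡 2) x)
    (φ : OpenPartialHomeomorph M Plane) (y : Plane) : Plane :=
  mfderiv (𝓡 2) (𝓡 2) φ (φ.symm y) (X (φ.symm y))

/-- `X` is a smooth vector field with `L_X g = 0`; in coordinates,
`X^k ∂_k g_ij + g_kj ∂_i X^k + g_ik ∂_j X^k = 0`. -/
def IsKillingField (X : (x : M) → TangentSpace (𝓡 2) x) : Prop :=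
  ContMDiff (𝓡 2) (𝓡 2).tangent ∞ (fun x => (⟨x, X x⟩ : TangentBundle (𝓡 2) M)) ∧
  ∀ φ ∈ IsManifold.maximalAtlas (𝓡 2) ∞ M, ∀ y ∈ φ.target, ∀ a b : Plane,
    fderiv ℝ (fun z => g.coord φ z a b) y (coordField X φ y)
      + g.coord φ y (fderiv ℝ (coordField X φ) y a) b
      + g.coord φ y a (fderiv ℝ (coordField X φ) y b) = 0

/-- `X` is spacelike at every point (spacelike vectors have negative square). -/
def IsSpacelikeField (X : (x : M) → TangentSpace (𝓡 2) x) : Prop :=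
  ∀ x, g.val x (X x) (X x) < 0

end LorentzMetric

end IsoEmbed

/-! The argument is dual to the Pfaffian formulation: instead of forms, it follows the complex
vector fields on `U × F` that a system annihilates. By Cartan's formula `dα(A, B) = A(α B) - B(α A)
- α[A, B]`, if every form of a system kills `A` and `B`, then every form of the derived system kills
`[A, B]` (`Annihilates.bracket`). Brackets of fields killed by `W` therefore give fields killed by
all of `W^∞`.

The Killing field `X` has an orthogonal partner `X'` with `[X, X'] = 0`. With `N = -g(X, X)` and `∇X
= f J`, the functions `f`, `N`, `K` are constant along `X`, and `X' N = 2fN`, `X' f = -KN`. In a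
frame adapted to `X, X'` all coefficients depend on one variable, with derivative `D` along `X'`.
Put `μ = i√K`, so `μ² = -K`. The fields killed by `W` are spanned by `P = D_X + R + μL` and `P' =
D_{X'} + R' + μL'`. Successive brackets give, up to nonzero factors and fields already found, `Z =
R₃ - μL₁₂ - mL` with `m = Dμ/(2μN)`, then `Q' = R' + eL'` and `Q = R - mN L₁₂ + aL`, and one more
round yields combinations of `L` and `L'` alone.

Darboux integrability forbids the latter. The conjugates of `P, P'` differ from `P, P'` by `2μL,
2μL'`; a nonzero combination of `L, L'` killed by `W^∞` would make a combination of the conjugate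
fields killed by both `W̄` and `W^∞`, although these span the cotangent space
(`eq_zero_of_forall_finalDerived`). So the coefficients vanish, and the resulting algebraic
relations force `m f = μ²` (`eq_sq_of_bracket_relations`), that is `f · X'K = -4K²N`
(`f_mul_fderiv_K`).

Together with the equations for `N` and `f` this is an ODE system with first integrals `K = r f⁴`
and `N = 1/(r f²) + b`. Since `g = N⁻¹ (⋆X♭)² - N (X♭/N)²`, where `X♭/N` is closed and `⋆X♭` is
proportional to `dN`, one takes `v` a multiple of a primitive of `X♭/N` and `u` a function of `N`.
The sign of `b` selects the normal form. -/

namespace IsoEmbed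

/-! ### Left-invariant fields on the frame bundle and evaluation of forms on complex vectors -/

/-- The left-invariant vector fields on the frame bundle, as linear fields on the ambient space:
the translations along the three frame vectors, and the infinitesimal rotations dual to
`ω¹₂`, `ω³₁`, `ω³₂`. -/
noncomputable def motion (i : Fin 6) : Amb →L[ℝ] Amb :=
  LinearMap.toContinuousLinearMap
    { toFun := fun z => match i with
        | 0 => (0, z.2.2 0, 0)
        | 1 => (0, z.2.2 1, 0)
        | 2 => (0, z.2.2 2, 0)
        | 3 => (0, 0, ![z.2.2 1, z.2.2 0, 0])
        | 4 => (0, 0, ![z.2.2 2, 0, z.2.2 0])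
        | 5 => (0, 0, ![0, z.2.2 2, -z.2.2 1])
      map_add' := by
        intro x y
        fin_cases i <;> simp [neg_add_rev, add_comm]
      map_smul' := by
        intro c x
        fin_cases i <;> simp }

theorem motion_zero (z : Amb) : motion 0 z = (0, z.2.2 0, 0) := rfl
theorem motion_one (z : Amb) : motion 1 z = (0, z.2.2 1, 0) := rfl
theorem motion_two (z : Amb) : motion 2 z = (0, z.2.2 2, 0) := rfl
theorem motion_three (z : Amb) : motion 3 z = (0, 0, ![z.2.2 1, z.2.2 0, 0]) := rfl
theorem motion_four (z : Amb) : motion 4 z = (0, 0, ![z.2.2 2, 0, z.2.2 0]) := rfl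
theorem motion_five (z : Amb) : motion 5 z = (0, 0, ![0, z.2.2 2, -z.2.2 1]) := rfl

theorem motion_fst (i : Fin 6) (z : Amb) : (motion i z).1 = 0 := by
  fin_cases i <;> rfl

theorem motion_horizontal (i : Fin 6) (a : Plane) : motion i ((a, 0, 0) : Amb) = 0 := by
  fin_cases i <;> simp [motion_zero, motion_one, motion_two, motion_three, motion_four, motion_five]

/-- The value of a complex covector on the complex tangent vector `a + ∑ ξ i • motion i`. -/
noncomputable def ev (β : Amb →L[ℝ] ℂ) (z : Amb) (a : Plane) (ξ : Fin 6 → ℂ) : ℂ :=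
  β (a, 0, 0) + ∑ i, ξ i * β (motion i z)

/-- The value of a bilinear function on a pair of such complex tangent vectors. -/
noncomputable def evTwo (Φ : Amb → Amb → ℂ) (z : Amb) (a : Plane) (ξ : Fin 6 → ℂ)
    (b : Plane) (η : Fin 6 → ℂ) : ℂ :=
  Φ (a, 0, 0) (b, 0, 0) + ∑ i, η i * Φ (a, 0, 0) (motion i z)
    + ∑ j, ξ j * Φ (motion j z) (b, 0, 0)
    + ∑ j, ∑ i, ξ j * η i * Φ (motion j z) (motion i z)

theorem evTwo_wedge (β γ : Amb →L[ℝ] ℂ) (z : Amb) (a : Plane) (ξ : Fin 6 → ℂ)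
    (b : Plane) (η : Fin 6 → ℂ) :
    evTwo (wedge β γ) z a ξ b η = ev β z a ξ * ev γ z b η - ev β z b η * ev γ z a ξ := by
  simp only [evTwo, ev, wedge, Fin.sum_univ_six]
  ring

theorem evTwo_add (Φ Ψ : Amb → Amb → ℂ) (z : Amb) (a : Plane) (ξ : Fin 6 → ℂ)
    (b : Plane) (η : Fin 6 → ℂ) :
    evTwo (Φ + Ψ) z a ξ b η = evTwo Φ z a ξ b η + evTwo Ψ z a ξ b η := by
  simp only [evTwo, Pi.add_apply, mul_add, Finset.sum_add_distrib]
  ring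

theorem evTwo_smul (c : ℂ) (Φ : Amb → Amb → ℂ) (z : Amb) (a : Plane) (ξ : Fin 6 → ℂ)
    (b : Plane) (η : Fin 6 → ℂ) :
    evTwo (c • Φ) z a ξ b η = c * evTwo Φ z a ξ b η := by
  simp only [evTwo, Pi.smul_apply, smul_eq_mul, mul_add, Finset.mul_sum]
  congr 1
  · congr 1
    · congr 1
      exact Finset.sum_congr rfl fun i _ => by ring
    · exact Finset.sum_congr rfl fun i _ => by ring
  · exact Finset.sum_congr rfl fun i _ => Finset.sum_congr rfl fun j _ => by ring

/-- A product `β ∧ γ` vanishes on a pair of vectors both killed by `β`, and this passes to linear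
combinations. -/
theorem evTwo_eq_zero_of_mem_ideal {S : Set (Amb → Amb →L[ℝ] ℂ)} {z : Amb} {a b : Plane}
    {ξ η : Fin 6 → ℂ} (ha : ∀ β ∈ S, ev (β z) z a ξ = 0) (hb : ∀ β ∈ S, ev (β z) z b η = 0)
    {Ψ : Amb → Amb → ℂ}
    (hΨ : Ψ ∈ Submodule.span ℂ
      {Φ : Amb → Amb → ℂ | ∃ β ∈ S, ∃ γ : Amb →L[ℝ] ℂ, Φ = wedge (β z) γ}) :
    evTwo Ψ z a ξ b η = 0 := by
  induction hΨ using Submodule.span_induction with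
  | mem Φ h =>
    obtain ⟨β, hβ, γ, rfl⟩ := h
    rw [evTwo_wedge, ha β hβ, hb β hβ]
    ring
  | zero => simp [evTwo]
  | add Φ Ψ _ _ h₁ h₂ => rw [evTwo_add, h₁, h₂, add_zero]
  | smul c Φ _ h => rw [evTwo_smul, h, mul_zero]

/-- The bracket of the complexified Lie algebra of motions, in the basis `motion`. -/
def motionBracket (ξ η : Fin 6 → ℂ) : Fin 6 → ℂ :=
  ![ξ 3 * η 1 - η 3 * ξ 1 + (ξ 4 * η 2 - η 4 * ξ 2),
    ξ 3 * η 0 - η 3 * ξ 0 - (ξ 5 * η 2 - η 5 * ξ 2),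
    ξ 4 * η 0 - η 4 * ξ 0 + (ξ 5 * η 1 - η 5 * ξ 1),
    ξ 4 * η 5 - η 4 * ξ 5,
    ξ 5 * η 3 - η 5 * ξ 3,
    ξ 4 * η 3 - η 4 * ξ 3]

/-- The motions are linear vector fields on the ambient space, and the bracket of `z ↦ A z` and `z ↦
B z` is `z ↦ (B A - A B) z`; hence the order of composition on the left. The structure constants
hold at every ambient point, not only at orthonormal frames. -/
theorem sum_motionBracket (β : Amb →L[ℝ] ℂ) (z : Amb) (ξ η : Fin 6 → ℂ) :
    ∑ j, ∑ i, ξ j * η i * (β (motion i (motion j z)) - β (motion j (motion i z)))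
      = ∑ k, motionBracket ξ η k * β (motion k z) := by
  have key : ∀ (i j : Fin 6) (w : Amb), motion i (motion j z) - motion j (motion i z) = w →
      β (motion i (motion j z)) - β (motion j (motion i z)) = β w := by
    intro i j w h
    rw [← map_sub, h]
  have h01 := key 0 1 0 (by simp [motion_zero, motion_one])
  have h02 := key 0 2 0 (by simp [motion_zero, motion_two])
  have h12 := key 1 2 0 (by simp [motion_one, motion_two])
  have h03 := key 0 3 (motion 1 z) (by simp [motion_zero, motion_three, motion_one])
  have h13 := key 1 3 (motion 0 z) (by simp [motion_zero, motion_three, motion_one])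
  have h23 := key 2 3 0 (by simp [motion_two, motion_three])
  have h04 := key 0 4 (motion 2 z) (by simp [motion_zero, motion_four, motion_two])
  have h14 := key 1 4 0 (by simp [motion_one, motion_four])
  have h24 := key 2 4 (motion 0 z) (by simp [motion_zero, motion_four, motion_two])
  have h05 := key 0 5 0 (by simp [motion_zero, motion_five])
  have h15 := key 1 5 (motion 2 z) (by simp [motion_one, motion_five, motion_two])
  have h25 := key 2 5 (-motion 1 z) (by simp [motion_two, motion_five, motion_one])
  have h34 := key 3 4 (motion 5 z) (by simp [motion_three, motion_four, motion_five])
  have h35 := key 3 5 (motion 4 z) (by simp [motion_three, motion_four, motion_five])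
  have h45 := key 4 5 (-motion 3 z) (by
    simp only [motion_three, motion_four, motion_five]
    ext i j <;> fin_cases i <;> simp)
  simp only [map_zero, map_neg] at h01 h02 h12 h23 h14 h05 h25 h45
  simp only [Fin.sum_univ_six, motionBracket, Matrix.cons_val]
  linear_combination (ξ 1 * η 0 - ξ 0 * η 1) * h01 + (ξ 2 * η 0 - ξ 0 * η 2) * h02
    + (ξ 2 * η 1 - ξ 1 * η 2) * h12 + (ξ 3 * η 0 - ξ 0 * η 3) * h03
    + (ξ 3 * η 1 - ξ 1 * η 3) * h13 + (ξ 3 * η 2 - ξ 2 * η 3) * h23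
    + (ξ 4 * η 0 - ξ 0 * η 4) * h04 + (ξ 4 * η 1 - ξ 1 * η 4) * h14
    + (ξ 4 * η 2 - ξ 2 * η 4) * h24 + (ξ 5 * η 0 - ξ 0 * η 5) * h05
    + (ξ 5 * η 1 - ξ 1 * η 5) * h15 + (ξ 5 * η 2 - ξ 2 * η 5) * h25
    + (ξ 4 * η 3 - ξ 3 * η 4) * h34 + (ξ 5 * η 3 - ξ 3 * η 5) * h35
    + (ξ 5 * η 4 - ξ 4 * η 5) * h45

/-! ### Tangent vectors of the frame bundle realised by curves -/

/-- `v` is the velocity of a curve in `N` through `z`. -/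
def IsVelocity (N : Set Amb) (z v : Amb) : Prop :=
  ∃ γ : ℝ → Amb, γ 0 = z ∧ HasDerivAt γ v 0 ∧ ∀ᶠ t in nhds (0 : ℝ), γ t ∈ N

/-- Forms live on the ambient space but vanishing is known only on `U × F`. This lets such an
identity be differentiated in directions tangent to the submanifold. -/
theorem IsVelocity.hasFDerivAt_apply_eq_zero {N : Set Amb} {z v : Amb} (hv : IsVelocity N z v)
    {h : Amb → ℂ} {h' : Amb →L[ℝ] ℂ} (hd : HasFDerivAt h h' z) (h0 : ∀ w ∈ N, h w = 0) :
    h' v = 0 := by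
  obtain ⟨γ, rfl, hγ, hN⟩ := hv
  have h1 : HasDerivAt (h ∘ γ) (h' v) 0 := hd.comp_hasDerivAt 0 hγ
  have h2 : (h ∘ γ) =ᶠ[nhds 0] fun _ => (0 : ℂ) := by
    filter_upwards [hN] with t ht using h0 _ ht
  exact h1.unique ((hasDerivAt_const (0 : ℝ) (0 : ℂ)).congr_of_eventuallyEq h2)

theorem mink_apply (v w : Fin 3 → ℝ) : mink v w = v 0 * w 0 - v 1 * w 1 - v 2 * w 2 := by
  simp [mink, sgn, Fin.sum_univ_three]
  ring

theorem mink_comm (v w : Fin 3 → ℝ) : mink v w = mink w v := by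
  rw [mink_apply, mink_apply]
  ring

theorem isVelocity_horizontal {U : Set Plane} (hU : IsOpen U) {z : Amb} (hz : z ∈ frameDomain U)
    (a : Plane) : IsVelocity (frameDomain U) z (a, 0, 0) := by
  have hc : HasDerivAt (fun t : ℝ => z.1 + t • a) a 0 := by
    simpa using ((hasDerivAt_id (0 : ℝ)).smul_const a).const_add z.1
  refine ⟨fun t => (z.1 + t • a, z.2), by simp, ?_, ?_⟩
  · exact hc.prodMk (hasDerivAt_const (0 : ℝ) z.2)
  · have : (fun t : ℝ => z.1 + t • a) ⁻¹' U ∈ nhds (0 : ℝ) :=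
      hc.continuousAt.preimage_mem_nhds (hU.mem_nhds (by simpa using hz.1))
    filter_upwards [this] with t ht
    exact ⟨ht, hz.2⟩

theorem isVelocity_translation {U : Set Plane} {z : Amb} (hz : z ∈ frameDomain U)
    (i : Fin 3) : IsVelocity (frameDomain U) z (0, z.2.2 i, 0) := by
  have hc : HasDerivAt (fun t : ℝ => z.2.1 + t • z.2.2 i) (z.2.2 i) 0 := by
    simpa using ((hasDerivAt_id (0 : ℝ)).smul_const (z.2.2 i)).const_add z.2.1
  refine ⟨fun t => (z.1, z.2.1 + t • z.2.2 i, z.2.2), by simp, ?_, ?_⟩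
  · exact (hasDerivAt_const (0 : ℝ) z.1).prodMk (hc.prodMk (hasDerivAt_const (0 : ℝ) z.2.2))
  · exact Filter.Eventually.of_forall fun t => hz

/-- A curve `A` in `SO(1,2)` starting at the identity acts on the frame by recombining its vectors,
so orthonormality (`hG`) and orientation (`hdet`) persist. It is applied to two boosts and one
rotation. -/
theorem isVelocity_rotation {U : Set Plane} {z : Amb} (hz : z ∈ frameDomain U)
    (A : ℝ → Matrix (Fin 3) (Fin 3) ℝ) (A' : Matrix (Fin 3) (Fin 3) ℝ) (h0 : A 0 = 1)
    (hA : ∀ i j, HasDerivAt (fun t => A t i j) (A' i j) 0)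
    (hG : ∀ t i k, ∑ j, A t i j * (A t k j * sgn j) = if i = k then sgn i else 0)
    (hdet : ∀ t, (A t).det = 1) :
    IsVelocity (frameDomain U) z (0, 0, fun i => ∑ j, A' i j • z.2.2 j) := by
  refine ⟨fun t => (z.1, z.2.1, fun i => ∑ j, A t i j • z.2.2 j), ?_, ?_, ?_⟩
  · ext i <;> simp [h0, Matrix.one_apply, ite_apply]
  · refine (hasDerivAt_const (0 : ℝ) z.1).prodMk ((hasDerivAt_const (0 : ℝ) z.2.1).prodMk ?_)
    refine hasDerivAt_pi.2 fun i => ?_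
    exact HasDerivAt.fun_sum fun j _ => (hA i j).smul_const (z.2.2 j)
  · refine Filter.Eventually.of_forall fun t => ⟨hz.1, fun i j => ?_, ?_⟩
    · have hs : ∀ v : Fin 3 → ℝ, mink (∑ k, A t i k • z.2.2 k) v
          = ∑ k, A t i k * mink (z.2.2 k) v := by
        intro v
        rw [mink_comm, map_sum]
        exact Finset.sum_congr rfl fun k _ => by rw [map_smul, mink_comm, smul_eq_mul]
      simp only [hs, map_sum, map_smul, hz.2.1]
      rw [← hG t i j]
      simp
    · have : Matrix.of (fun i => ∑ j, A t i j • z.2.2 j) = A t * Matrix.of z.2.2 := by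
        ext i j
        simp [Matrix.mul_apply]
      simp only [this, Matrix.det_mul, hdet, hz.2.2, mul_one]

theorem isVelocity_motion {U : Set Plane} {z : Amb} (hz : z ∈ frameDomain U) (i : Fin 6) :
    IsVelocity (frameDomain U) z (motion i z) := by
  have hs : HasDerivAt Real.sinh 1 0 := by simpa using Real.hasDerivAt_sinh 0
  have hc : HasDerivAt Real.cosh 0 0 := by simpa using Real.hasDerivAt_cosh 0
  have hs' : HasDerivAt Real.sin 1 0 := by simpa using Real.hasDerivAt_sin 0
  have hc' : HasDerivAt Real.cos 0 0 := by simpa using Real.hasDerivAt_cos 0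
  have hcst := fun r : ℝ => hasDerivAt_const (0 : ℝ) r
  fin_cases i
  · exact isVelocity_translation hz 0
  · exact isVelocity_translation hz 1
  · exact isVelocity_translation hz 2
  · have := isVelocity_rotation hz
      (fun t => !![Real.cosh t, Real.sinh t, 0; Real.sinh t, Real.cosh t, 0; 0, 0, 1])
      !![0, 1, 0; 1, 0, 0; 0, 0, 0] ?_ ?_ ?_ ?_
    · have e : motion 3 z = _ := motion_three z
      change IsVelocity _ _ (motion 3 z)
      rw [e]
      convert this using 3
      funext i
      fin_cases i <;> simp [Fin.sum_univ_three]
    · simp [Matrix.one_fin_three]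
    · intro i j
      fin_cases i <;> fin_cases j <;> simp [hs, hc, hcst]
    · intro t
      have h := Real.cosh_sq t
      intro i j
      fin_cases i <;> fin_cases j <;> simp [Fin.sum_univ_three, sgn] <;> nlinarith
    · intro t
      have h := Real.cosh_sq t
      simp [Matrix.det_fin_three]
      nlinarith
  · have := isVelocity_rotation hz
      (fun t => !![Real.cosh t, 0, Real.sinh t; 0, 1, 0; Real.sinh t, 0, Real.cosh t])
      !![0, 0, 1; 0, 0, 0; 1, 0, 0] ?_ ?_ ?_ ?_
    · have e : motion 4 z = _ := motion_four z
      change IsVelocity _ _ (motion 4 z)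
      rw [e]
      convert this using 3
      funext i
      fin_cases i <;> simp [Fin.sum_univ_three]
    · simp [Matrix.one_fin_three]
    · intro i j
      fin_cases i <;> fin_cases j <;> simp [hs, hc, hcst]
    · intro t
      have h := Real.cosh_sq t
      intro i j
      fin_cases i <;> fin_cases j <;> simp [Fin.sum_univ_three, sgn] <;> nlinarith
    · intro t
      have h := Real.cosh_sq t
      simp [Matrix.det_fin_three]
      nlinarith
  · have := isVelocity_rotation hz
      (fun t => !![1, 0, 0; 0, Real.cos t, Real.sin t; 0, -Real.sin t, Real.cos t])
      !![0, 0, 0; 0, 0, 1; 0, -1, 0] ?_ ?_ ?_ ?_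
    · have e : motion 5 z = _ := motion_five z
      change IsVelocity _ _ (motion 5 z)
      rw [e]
      convert this using 3
      funext i
      fin_cases i <;> simp [Fin.sum_univ_three]
    · simp [Matrix.one_fin_three]
    · intro i j
      fin_cases i <;> fin_cases j <;> simp [hs', hc', hcst]
      exact hs'.neg
    · intro t
      have h := Real.sin_sq_add_cos_sq t
      intro i j
      fin_cases i <;> fin_cases j <;> simp [Fin.sum_univ_three, sgn] <;> nlinarith
    · intro t
      have h := Real.sin_sq_add_cos_sq t
      simp [Matrix.det_fin_three]
      nlinarith

theorem horizontal_mem_frameTangent (z : Amb) (a : Plane) :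
    ((a, 0, 0) : Amb) ∈ frameTangent z := by
  intro i j
  simp

theorem motion_mem_frameTangent {U : Set Plane} {z : Amb} (hz : z ∈ frameDomain U) (i : Fin 6) :
    motion i z ∈ frameTangent z := by
  intro j k
  have h := hz.2.1
  fin_cases i
  · simp [motion_zero]
  · simp [motion_one]
  · simp [motion_two]
  · fin_cases j <;> fin_cases k <;> simp [motion_three, h, sgn]
  · fin_cases j <;> fin_cases k <;> simp [motion_four, h, sgn]
  · fin_cases j <;> fin_cases k <;> simp [motion_five, h, sgn]

/-- Restriction of `ev` to covectors agreeing on the tangent space. -/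
theorem ev_congr {U : Set Plane} {z : Amb} (hz : z ∈ frameDomain U) {α β : Amb →L[ℝ] ℂ}
    (h : ∀ v ∈ frameTangent z, α v = β v) (a : Plane) (ξ : Fin 6 → ℂ) :
    ev α z a ξ = ev β z a ξ := by
  simp only [ev, h _ (horizontal_mem_frameTangent z a), h _ (motion_mem_frameTangent hz _)]

theorem evTwo_congr {U : Set Plane} {z : Amb} (hz : z ∈ frameDomain U) {Φ Ψ : Amb → Amb → ℂ}
    (h : ∀ v ∈ frameTangent z, ∀ w ∈ frameTangent z, Φ v w = Ψ v w) (a b : Plane)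
    (ξ η : Fin 6 → ℂ) : evTwo Φ z a ξ b η = evTwo Ψ z a ξ b η := by
  simp only [evTwo, h _ (horizontal_mem_frameTangent z _) _ (horizontal_mem_frameTangent z _),
    h _ (horizontal_mem_frameTangent z _) _ (motion_mem_frameTangent hz _),
    h _ (motion_mem_frameTangent hz _) _ (horizontal_mem_frameTangent z _),
    h _ (motion_mem_frameTangent hz _) _ (motion_mem_frameTangent hz _)]

/-! ### Brackets of annihilated fields and the derived flag -/

/-- Derivative of `z ↦ ev (α z) z (b z.1) (η z.1)`. -/
theorem hasFDerivAt_ev {α : Amb → Amb →L[ℝ] ℂ} {z : Amb} (hα : DifferentiableAt ℝ α z)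
    {b : Plane → Plane} (hb : DifferentiableAt ℝ b z.1) {η : Fin 6 → Plane → ℂ}
    (hη : ∀ i, DifferentiableAt ℝ (η i) z.1) :
    ∃ D : Amb →L[ℝ] ℂ, HasFDerivAt (fun w : Amb => ev (α w) w (b w.1) (fun i => η i w.1)) D z ∧
      ∀ v, D v = fderiv ℝ α z v (b z.1, 0, 0) + α z (fderiv ℝ b z.1 v.1, 0, 0)
        + ∑ i, (η i z.1 * (fderiv ℝ α z v (motion i z) + α z (motion i v))
          + fderiv ℝ (η i) z.1 v.1 * α z (motion i z)) := by
  have h1 : HasFDerivAt (fun w : Amb => ((b w.1, 0, 0) : Amb))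
      ((ContinuousLinearMap.inl ℝ Plane ((Fin 3 → ℝ) × (Fin 3 → Fin 3 → ℝ)))
        ∘L ((fderiv ℝ b z.1) ∘L ContinuousLinearMap.fst ℝ Plane _)) z :=
    (ContinuousLinearMap.inl ℝ Plane ((Fin 3 → ℝ) × (Fin 3 → Fin 3 → ℝ))).hasFDerivAt.comp z
      (hb.hasFDerivAt.comp z hasFDerivAt_fst)
  have h2 := hα.hasFDerivAt.clm_apply h1
  have h3 : ∀ i, HasFDerivAt (fun w : Amb => η i w.1)
      ((fderiv ℝ (η i) z.1) ∘L ContinuousLinearMap.fst ℝ Plane _) z := fun i =>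
    (hη i).hasFDerivAt.comp z hasFDerivAt_fst
  have h4 := fun i => (h3 i).mul (hα.hasFDerivAt.clm_apply ((motion i).hasFDerivAt (x := z)))
  refine ⟨_, h2.add (HasFDerivAt.fun_sum fun i (_ : i ∈ Finset.univ) => h4 i), fun v => ?_⟩
  have e : ∀ x : Plane, ((x, 0) : Amb) = (x, 0, 0) := fun _ => rfl
  simp [Finset.sum_add_distrib, mul_add, mul_comm]
  rw [e]
  ring

theorem isOpen_cylinder {U : Set Plane} (hU : IsOpen U) : IsOpen {z : Amb | z.1 ∈ U} :=
  hU.preimage continuous_fst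

/-- All members of `S` annihilate the complex vector field `a + ∑ ξ i • motion i` on the frame
bundle. -/
def Annihilates (U : Set Plane) (S : Set (Amb → Amb →L[ℝ] ℂ)) (a : Plane → Plane)
    (ξ : Fin 6 → Plane → ℂ) : Prop :=
  ∀ α ∈ S, ∀ z ∈ frameDomain U, ev (α z) z (a z.1) (fun i => ξ i z.1) = 0

/-- The bookkeeping of Cartan's formula in components. The first four hypotheses differentiate `α(B)
= 0` and `α(A) = 0`, the fifth is `dα(A, B) = 0`, and the conclusion is `α([A, B]) = 0`. Here `w j
i` stands for the derivative of `α` along motion `j` applied to motion `i`, and `m j i` for `α` on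
the composite of motion `i` after motion `j`. -/
theorem sum_bracket_identity {p q u v : ℂ} {x y u' v' s t r dx dy : Fin 6 → ℂ}
    {w m : Fin 6 → Fin 6 → ℂ}
    (h₁ : p + u + ∑ i, (y i * u' i + dy i * r i) = 0)
    (h₂ : q + v + ∑ i, (x i * v' i + dx i * r i) = 0)
    (h₃ : ∀ j, s j + ∑ i, y i * (w j i + m j i) = 0)
    (h₄ : ∀ j, t j + ∑ i, x i * (w j i + m j i) = 0)
    (h₅ : p - q + ∑ i, y i * (u' i - t i) + ∑ j, x j * (s j - v' j)
      + ∑ j, ∑ i, x j * y i * (w j i - w i j) = 0) :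
    u - v + ∑ k, (dy k - dx k) * r k + ∑ j, ∑ i, x j * y i * (m j i - m i j) = 0 := by
  have h₃' : ∑ j, x j * (s j + ∑ i, y i * (w j i + m j i)) = 0 :=
    Finset.sum_eq_zero fun j _ => by rw [h₃ j, mul_zero]
  have h₄' : ∑ j, y j * (t j + ∑ i, x i * (w j i + m j i)) = 0 :=
    Finset.sum_eq_zero fun j _ => by rw [h₄ j, mul_zero]
  have hw : ∑ j, ∑ i, y j * (x i * w j i) = ∑ j, ∑ i, x j * (y i * w i j) := by
    rw [Finset.sum_comm]
    exact Finset.sum_congr rfl fun _ _ => Finset.sum_congr rfl fun _ _ => by ring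
  have hm : ∑ j, ∑ i, y j * (x i * m j i) = ∑ j, ∑ i, x j * (y i * m i j) := by
    rw [Finset.sum_comm]
    exact Finset.sum_congr rfl fun _ _ => Finset.sum_congr rfl fun _ _ => by ring
  simp only [mul_add, mul_sub, sub_mul, mul_assoc, Finset.sum_add_distrib, Finset.sum_sub_distrib,
    Finset.mul_sum] at h₁ h₂ h₃' h₄' h₅ hw hm ⊢
  linear_combination h₁ - h₂ + h₃' - h₄' - h₅ + hw + hm

/-- The derived system annihilates the brackets of vector fields annihilated by the system. -/
theorem Annihilates.bracket {U : Set Plane} (hU : IsOpen U) {S : Set (Amb → Amb →L[ℝ] ℂ)}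
    (hS : ∀ α ∈ S, ContDiffOn ℝ ∞ α {z : Amb | z.1 ∈ U})
    {a b : Plane → Plane} {ξ η : Fin 6 → Plane → ℂ}
    (hA : Annihilates U S a ξ) (hB : Annihilates U S b η)
    (ha : ∀ y ∈ U, DifferentiableAt ℝ a y) (hb : ∀ y ∈ U, DifferentiableAt ℝ b y)
    (hξ : ∀ y ∈ U, ∀ i, DifferentiableAt ℝ (ξ i) y)
    (hη : ∀ y ∈ U, ∀ i, DifferentiableAt ℝ (η i) y) :
    Annihilates U (derivedSystem (frameDomain U) frameTangent S)
      (fun y => fderiv ℝ b y (a y) - fderiv ℝ a y (b y))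
      (fun k y => fderiv ℝ (η k) y (a y) - fderiv ℝ (ξ k) y (b y)
        + motionBracket (fun i => ξ i y) (fun i => η i y) k) := by
  rintro α ⟨hα, hd⟩ z hz
  have hαz : DifferentiableAt ℝ α z :=
    ((hS α hα).contDiffAt ((isOpen_cylinder hU).mem_nhds hz.1)).differentiableAt (by simp)
  obtain ⟨D, hD, hDv⟩ := hasFDerivAt_ev hαz (hb z.1 hz.1) (hη z.1 hz.1)
  obtain ⟨D', hD', hDv'⟩ := hasFDerivAt_ev hαz (ha z.1 hz.1) (hξ z.1 hz.1)
  -- Both `α(A)` and `α(B)` vanish on `U × F`, so their derivatives vanish along base directions and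
  -- along every motion.
  have h1 := (isVelocity_horizontal hU hz (a z.1)).hasFDerivAt_apply_eq_zero hD (hB α hα)
  have h2 := (isVelocity_horizontal hU hz (b z.1)).hasFDerivAt_apply_eq_zero hD' (hA α hα)
  have h3 := fun j => (isVelocity_motion hz j).hasFDerivAt_apply_eq_zero hD (hB α hα)
  have h4 := fun j => (isVelocity_motion hz j).hasFDerivAt_apply_eq_zero hD' (hA α hα)
  have hz0 : α z ((0, 0, 0) : Amb) = 0 := (α z).map_zero
  simp only [hDv, hDv', motion_horizontal, motion_fst, map_zero, hz0, add_zero, zero_mul]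
    at h1 h2 h3 h4
  obtain ⟨Ψ, hΨ, hΨe⟩ := hd z hz
  have h5 : evTwo (extD α z) z (a z.1) (fun i => ξ i z.1) (b z.1) (fun i => η i z.1) = 0 := by
    rw [evTwo_congr hz hΨe]
    exact evTwo_eq_zero_of_mem_ideal (fun β hβ => hA β hβ z hz) (fun β hβ => hB β hβ z hz) hΨ
  have h6 := sum_motionBracket (α z) z (fun i => ξ i z.1) (fun i => η i z.1)
  have e : ev (α z) z (fderiv ℝ b z.1 (a z.1) - fderiv ℝ a z.1 (b z.1))
      (fun k => fderiv ℝ (η k) z.1 (a z.1) - fderiv ℝ (ξ k) z.1 (b z.1)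
        + motionBracket (fun i => ξ i z.1) (fun i => η i z.1) k)
      = α z (fderiv ℝ b z.1 (a z.1), 0, 0) - α z (fderiv ℝ a z.1 (b z.1), 0, 0)
        + ∑ k, (fderiv ℝ (η k) z.1 (a z.1) - fderiv ℝ (ξ k) z.1 (b z.1)) * α z (motion k z)
        + ∑ j, ∑ i, ξ j z.1 * η i z.1 *
          (α z (motion i (motion j z)) - α z (motion j (motion i z))) := by
    rw [h6]
    have : ((fderiv ℝ b z.1 (a z.1) - fderiv ℝ a z.1 (b z.1), 0, 0) : Amb)
        = (fderiv ℝ b z.1 (a z.1), 0, 0) - (fderiv ℝ a z.1 (b z.1), 0, 0) := by simp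
    simp only [ev, this, map_sub, add_mul, Finset.sum_add_distrib]
    ring
  rw [e]
  exact sum_bracket_identity h1 h2 h3 h4 h5

/-- The members of the derived flag. -/
def derivedFlag (U : Set Plane) (S : Set (Amb → Amb →L[ℝ] ℂ)) (k : ℕ) :
    Set (Amb → Amb →L[ℝ] ℂ) :=
  (derivedSystem (frameDomain U) frameTangent)^[k] S

theorem derivedFlag_succ (U : Set Plane) (S : Set (Amb → Amb →L[ℝ] ℂ)) (k : ℕ) :
    derivedFlag U S (k + 1)
      = derivedSystem (frameDomain U) frameTangent (derivedFlag U S k) :=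
  Function.iterate_succ_apply' _ _ _

theorem derivedFlag_succ_subset (U : Set Plane) (S : Set (Amb → Amb →L[ℝ] ℂ)) (k : ℕ) :
    derivedFlag U S (k + 1) ⊆ derivedFlag U S k := by
  rw [derivedFlag_succ]
  exact fun α h => h.1

theorem derivedFlag_subset (U : Set Plane) (S : Set (Amb → Amb →L[ℝ] ℂ)) (k : ℕ) :
    derivedFlag U S k ⊆ S := by
  induction k with
  | zero => exact subset_rfl
  | succ k ih => exact (derivedFlag_succ_subset U S k).trans ih

theorem finalDerived_subset (U : Set Plane) (S : Set (Amb → Amb →L[ℝ] ℂ)) (k : ℕ) :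
    finalDerived (frameDomain U) frameTangent S ⊆ derivedFlag U S k :=
  Set.iInter_subset _ k

/-! ### Fields adapted to the Killing field -/

/-- A spacelike Killing field `X` with components `x₁, x₂` in an orthonormal framing, the orthogonal
field `X'` with components `x₂, x₁`, and the function `f` with `∇X = f J`. -/
structure KillingFrame {U : Set Plane} (c : CartanFrame U) where
  X : Plane → Plane
  X' : Plane → Plane
  x₁ : Plane → ℝ
  x₂ : Plane → ℝ
  f : Plane → ℝ
  smooth_X : ContDiffOn ℝ ∞ X U
  smooth_X' : ContDiffOn ℝ ∞ X' U
  smooth_x₁ : ContDiffOn ℝ ∞ x₁ U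
  smooth_x₂ : ContDiffOn ℝ ∞ x₂ U
  smooth_f : ContDiffOn ℝ ∞ f U
  η₁_X : ∀ y ∈ U, c.η₁ y (X y) = x₁ y
  η₂_X : ∀ y ∈ U, c.η₂ y (X y) = x₂ y
  η₁_X' : ∀ y ∈ U, c.η₁ y (X' y) = x₂ y
  η₂_X' : ∀ y ∈ U, c.η₂ y (X' y) = x₁ y
  d_x₁ : ∀ y ∈ U, ∀ v, fderiv ℝ x₁ y v = f y * c.η₂ y v - x₂ y * c.η₁₂ y v
  d_x₂ : ∀ y ∈ U, ∀ v, fderiv ℝ x₂ y v = f y * c.η₁ y v - x₁ y * c.η₁₂ y v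
  d_f : ∀ y ∈ U, ∀ v, fderiv ℝ f y v = -(c.K y * (x₂ y * c.η₁ y v - x₁ y * c.η₂ y v))
  commute : ∀ y ∈ U, fderiv ℝ X' y (X y) = fderiv ℝ X y (X' y)
  spacelike : ∀ y ∈ U, x₁ y ^ 2 < x₂ y ^ 2

theorem differentiableAt_of_contDiffOn {E F : Type*} [NormedAddCommGroup E] [NormedSpace ℝ E]
    [NormedAddCommGroup F] [NormedSpace ℝ F] {U : Set E} {h : E → F} (hU : IsOpen U)
    (hh : ContDiffOn ℝ ∞ h U) {y : E} (hy : y ∈ U) : DifferentiableAt ℝ h y :=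
  (hh.contDiffAt (hU.mem_nhds hy)).differentiableAt (by simp)

theorem hasFDerivAt_ofReal {h : Plane → ℝ} {y : Plane} (hh : DifferentiableAt ℝ h y) :
    HasFDerivAt (fun z => (h z : ℂ)) (Complex.ofRealCLM ∘L fderiv ℝ h y) y :=
  Complex.ofRealCLM.hasFDerivAt.comp y hh.hasFDerivAt

theorem hasFDerivAt_mul_add_mul {a b : Plane → ℂ} {p q : Plane → ℝ} {y : Plane}
    (ha : DifferentiableAt ℝ a y) (hb : DifferentiableAt ℝ b y)
    (hp : DifferentiableAt ℝ p y) (hq : DifferentiableAt ℝ q y) :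
    ∃ D : Plane →L[ℝ] ℂ, HasFDerivAt (fun z => a z * (p z : ℂ) + b z * (q z : ℂ)) D y ∧
      ∀ v, D v = fderiv ℝ a y v * p y + a y * (fderiv ℝ p y v : ℝ)
        + (fderiv ℝ b y v * q y + b y * (fderiv ℝ q y v : ℝ)) := by
  refine ⟨_, (ha.hasFDerivAt.mul (hasFDerivAt_ofReal hp)).add
    (hb.hasFDerivAt.mul (hasFDerivAt_ofReal hq)), fun v => ?_⟩
  simp
  ring

namespace KillingFrame

variable {U : Set Plane} {c : CartanFrame U} (k : KillingFrame c)

/-- `N = -g(X, X)`. -/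
def N (y : Plane) : ℝ := k.x₂ y ^ 2 - k.x₁ y ^ 2

/-- Coefficients, in the basis `motion`, of the vector field
`s D_X + t D_{X'} + ξ₀ R + ξ₁ R' + ξ₂ R₃ + ξ₃ L₁₂ + ξ₄ L + ξ₅ L'`, where `D` is the horizontal lift,
`R = x₁ R₁ + x₂ R₂`, `R' = x₂ R₁ + x₁ R₂`, `L = x₂ L₃₁ - x₁ L₃₂`, `L' = x₁ L₃₁ - x₂ L₃₂`. -/
noncomputable def coeff (s t : ℝ) (ξ : Fin 6 → Plane → ℂ) : Fin 6 → Plane → ℂ :=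
  ![fun y => ξ 0 y * (k.x₁ y : ℂ) + ξ 1 y * (k.x₂ y : ℂ),
    fun y => ξ 0 y * (k.x₂ y : ℂ) + ξ 1 y * (k.x₁ y : ℂ),
    ξ 2,
    fun y => ξ 3 y * ((1 : ℝ) : ℂ) + 1 * ((s * c.η₁₂ y (k.X y) + t * c.η₁₂ y (k.X' y) : ℝ) : ℂ),
    fun y => ξ 4 y * (k.x₂ y : ℂ) + ξ 5 y * (k.x₁ y : ℂ),
    fun y => -(ξ 4 y * (k.x₁ y : ℂ) + ξ 5 y * (k.x₂ y : ℂ))]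

/-- The system `S` annihilates the vector field with coefficients `coeff s t ξ`. -/
def Kills (S : Set (Amb → Amb →L[ℝ] ℂ)) (s t : ℝ) (ξ : Fin 6 → Plane → ℂ) : Prop :=
  Annihilates U S (fun y => s • k.X y + t • k.X' y) (k.coeff s t ξ)

/-- Coefficients of the bracket of two vector fields with coefficients that are constant along `X`,
`ξ'` and `η'` being their derivatives along `X'`. -/
noncomputable def bracketCoeff (s t : ℝ) (ξ ξ' : Fin 6 → Plane → ℂ) (s' t' : ℝ)
    (η η' : Fin 6 → Plane → ℂ) : Fin 6 → Plane → ℂ :=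
  ![fun y => t * η' 0 y - t' * ξ' 0 y + k.f y * (s * η 1 y + t * η 0 y - s' * ξ 1 y - t' * ξ 0 y)
      + (ξ 5 y * η 2 y - η 5 y * ξ 2 y) + (ξ 3 y * η 1 y - η 3 y * ξ 1 y),
    fun y => t * η' 1 y - t' * ξ' 1 y + k.f y * (s * η 0 y + t * η 1 y - s' * ξ 0 y - t' * ξ 1 y)
      + (ξ 4 y * η 2 y - η 4 y * ξ 2 y) + (ξ 3 y * η 0 y - η 3 y * ξ 0 y),
    fun y => t * η' 2 y - t' * ξ' 2 y + k.N y * (ξ 4 y * η 1 y - η 4 y * ξ 1 y)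
      - k.N y * (ξ 5 y * η 0 y - η 5 y * ξ 0 y),
    fun y => t * η' 3 y - t' * ξ' 3 y + (s * t' - t * s') * c.K y * k.N y
      - k.N y * (ξ 4 y * η 5 y - ξ 5 y * η 4 y),
    fun y => t * η' 4 y - t' * ξ' 4 y + k.f y * (s * η 5 y + t * η 4 y - s' * ξ 5 y - t' * ξ 4 y)
      + (ξ 3 y * η 5 y - η 3 y * ξ 5 y),
    fun y => t * η' 5 y - t' * ξ' 5 y + k.f y * (s * η 4 y + t * η 5 y - s' * ξ 4 y - t' * ξ 5 y)
      + (ξ 3 y * η 4 y - η 3 y * ξ 4 y)]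

/-- Product rule. A direction `p X + q X'` differentiates the invariant coefficients only through
`q`, while the components `x₁`, `x₂` of `X` and the connection form vary in both directions. -/
theorem exists_fderiv_coeff (hU : IsOpen U) {s t : ℝ} {ξ ξ' : Fin 6 → Plane → ℂ} {y : Plane}
    (hy : y ∈ U) (hξ : ∀ i, DifferentiableAt ℝ (ξ i) y)
    (hX : ∀ i, fderiv ℝ (ξ i) y (k.X y) = 0) (hX' : ∀ i, fderiv ℝ (ξ i) y (k.X' y) = ξ' i y) :
    (∀ i, DifferentiableAt ℝ (k.coeff s t ξ i) y) ∧
    ∀ p q : ℝ, ∀ v, v = p • k.X y + q • k.X' y → ∀ i, fderiv ℝ (k.coeff s t ξ i) y v =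
      (![q * (ξ' 0 y * k.x₁ y + ξ' 1 y * k.x₂ y) + ξ 0 y * (fderiv ℝ k.x₁ y v : ℝ)
          + ξ 1 y * (fderiv ℝ k.x₂ y v : ℝ),
        q * (ξ' 0 y * k.x₂ y + ξ' 1 y * k.x₁ y) + ξ 0 y * (fderiv ℝ k.x₂ y v : ℝ)
          + ξ 1 y * (fderiv ℝ k.x₁ y v : ℝ),
        q * ξ' 2 y,
        q * ξ' 3 y + s * ((fderiv ℝ c.η₁₂ y v (k.X y) + c.η₁₂ y (fderiv ℝ k.X y v) : ℝ) : ℂ)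
          + t * ((fderiv ℝ c.η₁₂ y v (k.X' y) + c.η₁₂ y (fderiv ℝ k.X' y v) : ℝ) : ℂ),
        q * (ξ' 4 y * k.x₂ y + ξ' 5 y * k.x₁ y) + ξ 4 y * (fderiv ℝ k.x₂ y v : ℝ)
          + ξ 5 y * (fderiv ℝ k.x₁ y v : ℝ),
        -(q * (ξ' 4 y * k.x₁ y + ξ' 5 y * k.x₂ y) + ξ 4 y * (fderiv ℝ k.x₁ y v : ℝ)
          + ξ 5 y * (fderiv ℝ k.x₂ y v : ℝ))] : Fin 6 → ℂ) i := by
  have d₁ := differentiableAt_of_contDiffOn hU k.smooth_x₁ hy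
  have d₂ := differentiableAt_of_contDiffOn hU k.smooth_x₂ hy
  have hη := (differentiableAt_of_contDiffOn hU c.smooth_η₁₂ hy).hasFDerivAt
  have e := hη.clm_apply (differentiableAt_of_contDiffOn hU k.smooth_X hy).hasFDerivAt
  have e' := hη.clm_apply (differentiableAt_of_contDiffOn hU k.smooth_X' hy).hasFDerivAt
  have e3 := (e.const_mul s).add (e'.const_mul t)
  obtain ⟨D0, h0, h0'⟩ := hasFDerivAt_mul_add_mul (hξ 0) (hξ 1) d₁ d₂
  obtain ⟨D1, h1, h1'⟩ := hasFDerivAt_mul_add_mul (hξ 0) (hξ 1) d₂ d₁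
  obtain ⟨D3, h3, h3'⟩ := hasFDerivAt_mul_add_mul (hξ 3) (differentiableAt_const (1 : ℂ))
    (differentiableAt_const (1 : ℝ)) e3.differentiableAt
  obtain ⟨D4, h4, h4'⟩ := hasFDerivAt_mul_add_mul (hξ 4) (hξ 5) d₂ d₁
  obtain ⟨D5, h5, h5'⟩ := hasFDerivAt_mul_add_mul (hξ 4) (hξ 5) d₁ d₂
  constructor
  · intro i
    fin_cases i
    · exact h0.differentiableAt
    · exact h1.differentiableAt
    · exact hξ 2
    · exact h3.differentiableAt
    · exact h4.differentiableAt
    · exact h5.neg.differentiableAt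
  · intro p q v hv i
    have hd : ∀ i, fderiv ℝ (ξ i) y v = q * ξ' i y := by
      intro i
      rw [hv, map_add, map_smul, map_smul, hX, hX', smul_zero, zero_add, Complex.real_smul]
    fin_cases i
    · refine (congrArg (· v) h0.fderiv).trans ((h0' v).trans ?_)
      simp only [hd]
      simp
      ring
    · refine (congrArg (· v) h1.fderiv).trans ((h1' v).trans ?_)
      simp only [hd]
      simp
      ring
    · exact hd 2
    · refine (congrArg (· v) h3.fderiv).trans ((h3' v).trans ?_)
      rw [e3.fderiv]
      simp only [hd]
      simp
      ring
    · refine (congrArg (· v) h4.fderiv).trans ((h4' v).trans ?_)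
      simp only [hd]
      simp
      ring
    · refine (congrArg (· v) h5.neg.fderiv).trans ((congrArg Neg.neg (h5' v)).trans ?_)
      simp only [hd]
      simp
      ring

/-- In the frame built from `X` and `X'`, the connection form cancels between the derivatives of
`x₁`, `x₂` and the rotation part of the horizontal lifts. Only `f`, `N`, `K` and derivatives along
`X'` survive, and since `[X, X'] = 0` the bracket has no horizontal part. -/
theorem Kills.bracket (hU : IsOpen U) {S : Set (Amb → Amb →L[ℝ] ℂ)}
    (hS : ∀ α ∈ S, ContDiffOn ℝ ∞ α {z : Amb | z.1 ∈ U}) {s t s' t' : ℝ}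
    {ξ ξ' η η' : Fin 6 → Plane → ℂ} (hA : k.Kills S s t ξ) (hB : k.Kills S s' t' η)
    (hξ : ∀ y ∈ U, ∀ i, DifferentiableAt ℝ (ξ i) y)
    (hη : ∀ y ∈ U, ∀ i, DifferentiableAt ℝ (η i) y)
    (hξX : ∀ y ∈ U, ∀ i, fderiv ℝ (ξ i) y (k.X y) = 0)
    (hηX : ∀ y ∈ U, ∀ i, fderiv ℝ (η i) y (k.X y) = 0)
    (hξX' : ∀ y ∈ U, ∀ i, fderiv ℝ (ξ i) y (k.X' y) = ξ' i y)
    (hηX' : ∀ y ∈ U, ∀ i, fderiv ℝ (η i) y (k.X' y) = η' i y) :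
    k.Kills (derivedSystem (frameDomain U) frameTangent S) 0 0
      (k.bracketCoeff s t ξ ξ' s' t' η η') := by
  have dX := fun y hy => differentiableAt_of_contDiffOn hU k.smooth_X (y := y) hy
  have dX' := fun y hy => differentiableAt_of_contDiffOn hU k.smooth_X' (y := y) hy
  have hlin : ∀ (s t : ℝ) (y : Plane), y ∈ U →
      HasFDerivAt (fun y => s • k.X y + t • k.X' y)
        (s • fderiv ℝ k.X y + t • fderiv ℝ k.X' y) y := fun s t y hy =>
    ((dX y hy).hasFDerivAt.const_smul s).add ((dX' y hy).hasFDerivAt.const_smul t)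
  have hξc := fun y hy => k.exists_fderiv_coeff hU (s := s) (t := t) hy (hξ y hy) (hξX y hy)
    (hξX' y hy)
  have hηc := fun y hy => k.exists_fderiv_coeff hU (s := s') (t := t') hy (hη y hy) (hηX y hy)
    (hηX' y hy)
  have main := Annihilates.bracket hU hS hA hB
    (fun y hy => (hlin s t y hy).differentiableAt) (fun y hy => (hlin s' t' y hy).differentiableAt)
    (fun y hy => (hξc y hy).1) (fun y hy => (hηc y hy).1)
  intro α hα z hz
  have hy := hz.1
  convert main α hα z hz using 1
  have hcomm := k.commute z.1 hy
  congr 1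
  · beta_reduce
    rw [(hlin s t z.1 hy).fderiv, (hlin s' t' z.1 hy).fderiv]
    simp only [add_apply, smul_apply, map_add, map_smul,
      hcomm]
    module
  · have hv := (hηc z.1 hy).2 s t _ rfl
    have hv' := (hξc z.1 hy).2 s' t' _ rfl
    -- The only place where curvature enters: `(η₁ ∧ η₂)(X, X') = x₁² - x₂² = -N`, so `dη₁₂(X, X') =
    -- K N`.
    have hs := c.d_η₁₂ z.1 hy (k.X z.1) (k.X' z.1)
    simp only [extD, wedge, k.η₁_X z.1 hy, k.η₂_X z.1 hy, k.η₁_X' z.1 hy, k.η₂_X' z.1 hy] at hs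
    funext i
    simp only [hv, hv', k.d_x₁ z.1 hy, k.d_x₂ z.1 hy, map_add, map_smul, k.η₁_X z.1 hy,
      k.η₂_X z.1 hy, k.η₁_X' z.1 hy, k.η₂_X' z.1 hy, smul_eq_mul, hcomm,
      add_apply, smul_apply]
    have hsC := congrArg (fun r : ℝ => (r : ℂ)) hs
    push_cast at hsC
    fin_cases i <;>
      simp only [coeff, bracketCoeff, motionBracket, N, Fin.zero_eta, Fin.mk_one, Fin.reduceFinMk,
        Matrix.cons_val] <;>
      push_cast
    · ring
    · ring
    · ring
    · linear_combination -(s * t' - t * s' : ℂ) * hsC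
    · ring
    · ring

end KillingFrame

/-! ### Annihilators of the singular systems and the transversality condition -/

theorem ev_add (β γ : Amb →L[ℝ] ℂ) (z : Amb) (a : Plane) (ξ : Fin 6 → ℂ) :
    ev (β + γ) z a ξ = ev β z a ξ + ev γ z a ξ := by
  simp only [ev, add_apply, mul_add, Finset.sum_add_distrib]
  ring

theorem ev_smul (r : ℂ) (β : Amb →L[ℝ] ℂ) (z : Amb) (a : Plane) (ξ : Fin 6 → ℂ) :
    ev (r • β) z a ξ = r * ev β z a ξ := by
  simp only [ev, smul_apply, smul_eq_mul, mul_add, Finset.mul_sum]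
  congr 1
  exact Finset.sum_congr rfl fun _ _ => by ring

theorem ev_sub (β γ : Amb →L[ℝ] ℂ) (z : Amb) (a : Plane) (ξ : Fin 6 → ℂ) :
    ev (β - γ) z a ξ = ev β z a ξ - ev γ z a ξ := by
  simp only [ev, sub_apply, mul_sub, Finset.sum_sub_distrib]
  ring

theorem toC_apply (β : Amb →L[ℝ] ℝ) (v : Amb) : toC β v = (β v : ℂ) := rfl

theorem toC_sub (β γ : Amb →L[ℝ] ℝ) : toC (β - γ) = toC β - toC γ :=
  ContinuousLinearMap.ext fun v => by simp [toC_apply]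

theorem ev_toC_pullPlane (η : Plane → Plane →L[ℝ] ℝ) (z : Amb) (a : Plane) (ξ : Fin 6 → ℂ) :
    ev (toC (pullPlane η z)) z a ξ = η z.1 a := by
  simp [ev, toC_apply, pullPlane, motion_fst]

theorem ev_toC_canon {U : Set Plane} {z : Amb} (hz : z ∈ frameDomain U) (i : Fin 3) (a : Plane)
    (ξ : Fin 6 → ℂ) : ev (toC (canon i z)) z a ξ = ![ξ 0, ξ 1, ξ 2] i := by
  have h := hz.2.1
  simp only [ev, toC_apply, canon, Fin.sum_univ_six, motion_zero, motion_one, motion_two,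
    motion_three, motion_four, motion_five]
  fin_cases i <;> simp [h, sgn]

theorem ev_toC_conn_zero_one {U : Set Plane} {z : Amb} (hz : z ∈ frameDomain U) (a : Plane)
    (ξ : Fin 6 → ℂ) : ev (toC (conn 0 1 z)) z a ξ = ξ 3 := by
  have h := hz.2.1
  simp only [ev, toC_apply, conn, Fin.sum_univ_six, motion_zero, motion_one, motion_two,
    motion_three, motion_four, motion_five]
  simp [h, sgn]

theorem ev_toC_conn_two_zero {U : Set Plane} {z : Amb} (hz : z ∈ frameDomain U) (a : Plane)
    (ξ : Fin 6 → ℂ) : ev (toC (conn 2 0 z)) z a ξ = ξ 4 := by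
  have h := hz.2.1
  simp only [ev, toC_apply, conn, Fin.sum_univ_six, motion_zero, motion_one, motion_two,
    motion_three, motion_four, motion_five]
  simp [h, sgn]

theorem ev_toC_conn_two_one {U : Set Plane} {z : Amb} (hz : z ∈ frameDomain U) (a : Plane)
    (ξ : Fin 6 → ℂ) : ev (toC (conn 2 1 z)) z a ξ = ξ 5 := by
  have h := hz.2.1
  simp only [ev, toC_apply, conn, Fin.sum_univ_six, motion_zero, motion_one, motion_two,
    motion_three, motion_four, motion_five]
  simp [h, sgn]

/-- The vector fields annihilated by a singular system. -/
theorem ev_eq_zero_of_mem_singularSystem {U : Set Plane} (c : CartanFrame U) {μ : Plane → ℂ}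
    {α : Amb → Amb →L[ℝ] ℂ} (hα : α ∈ c.singularSystem μ) {z : Amb} (hz : z ∈ frameDomain U)
    (a : Plane) {ξ : Fin 6 → ℂ} (h0 : ξ 0 = c.η₁ z.1 a) (h1 : ξ 1 = c.η₂ z.1 a) (h2 : ξ 2 = 0)
    (h3 : ξ 3 = c.η₁₂ z.1 a) (h4 : ξ 4 = μ z.1 * c.η₂ z.1 a)
    (h5 : ξ 5 = -(μ z.1 * c.η₁ z.1 a)) :
    ev (α z) z a ξ = 0 := by
  obtain ⟨β, hβ, hαβ⟩ := hα.2 z hz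
  rw [ev_congr hz hαβ]
  clear hαβ
  induction hβ using Submodule.span_induction with
  | mem β h =>
    rcases h with ⟨i, rfl⟩ | rfl | rfl
    · fin_cases i
      · change ev (toC (canon 2 z)) z a ξ = 0
        rw [ev_toC_canon hz]
        exact h2
      · change ev (toC (canon 0 z - pullPlane c.η₁ z)) z a ξ = 0
        rw [toC_sub, ev_sub, ev_toC_canon hz, ev_toC_pullPlane]
        simp [h0]
      · change ev (toC (canon 1 z - pullPlane c.η₂ z)) z a ξ = 0
        rw [toC_sub, ev_sub, ev_toC_canon hz, ev_toC_pullPlane]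
        simp [h1]
      · change ev (toC (conn 0 1 z - pullPlane c.η₁₂ z)) z a ξ = 0
        rw [toC_sub, ev_sub, ev_toC_conn_zero_one hz, ev_toC_pullPlane]
        simp [h3]
    · rw [ev_sub, ev_smul, ev_toC_conn_two_zero hz, ev_toC_pullPlane, h4, sub_self]
    · rw [ev_add, ev_smul, ev_toC_conn_two_one hz, ev_toC_pullPlane, h5]
      ring
  | zero => simp [ev]
  | add β γ _ _ h₁ h₂ => rw [ev_add, h₁, h₂, add_zero]
  | smul r β _ h => rw [ev_smul, h, mul_zero]

namespace KillingFrame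

variable {U : Set Plane} {c : CartanFrame U} (k : KillingFrame c)

/-- The values of a covector on the fields `R, R', R₃, L₁₂, L, L'`. -/
noncomputable def vert (β : Amb →L[ℝ] ℂ) (z : Amb) : Fin 6 → ℂ :=
  ![k.x₁ z.1 * β (motion 0 z) + k.x₂ z.1 * β (motion 1 z),
    k.x₂ z.1 * β (motion 0 z) + k.x₁ z.1 * β (motion 1 z),
    β (motion 2 z), β (motion 3 z),
    k.x₂ z.1 * β (motion 4 z) - k.x₁ z.1 * β (motion 5 z),
    k.x₁ z.1 * β (motion 4 z) - k.x₂ z.1 * β (motion 5 z)]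

/-- The values of a covector on the horizontal lifts of `X` and `X'`. -/
noncomputable def horiz (β : Amb →L[ℝ] ℂ) (z : Amb) : Fin 2 → ℂ :=
  ![β (k.X z.1, 0, 0) + c.η₁₂ z.1 (k.X z.1) * β (motion 3 z),
    β (k.X' z.1, 0, 0) + c.η₁₂ z.1 (k.X' z.1) * β (motion 3 z)]

/-- Change of basis: pairing with the field of coefficients `coeff s t ξ` becomes linear in `s`,
`t`, `ξ`, so later bracket relations are linear equations in `horiz` and `vert`. -/
theorem ev_coeff (β : Amb →L[ℝ] ℂ) (z : Amb) (s t : ℝ) (ξ : Fin 6 → Plane → ℂ) :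
    ev β z (s • k.X z.1 + t • k.X' z.1) (fun i => k.coeff s t ξ i z.1)
      = s * k.horiz β z 0 + t * k.horiz β z 1 + ∑ i, ξ i z.1 * k.vert β z i := by
  have : ((s • k.X z.1 + t • k.X' z.1, 0, 0) : Amb)
      = s • (k.X z.1, 0, 0) + t • (k.X' z.1, 0, 0) := by simp
  simp only [ev, this, map_add, map_smul, Fin.sum_univ_six, coeff, vert, horiz, Matrix.cons_val,
    Complex.real_smul]
  push_cast
  ring

theorem kills_iff (S : Set (Amb → Amb →L[ℝ] ℂ)) (s t : ℝ) (ξ : Fin 6 → Plane → ℂ) :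
    k.Kills S s t ξ ↔ ∀ α ∈ S, ∀ z ∈ frameDomain U, s * k.horiz (α z) z 0 + t * k.horiz (α z) z 1
      + ∑ i, ξ i z.1 * k.vert (α z) z i = 0 := by
  simp only [Kills, Annihilates, ev_coeff]

/-- Coefficients of the fields spanning the annihilator of a singular system. -/
def baseCoeff (μ : Plane → ℂ) : Fin 6 → Plane → ℂ :=
  ![fun _ => 1, fun _ => 0, fun _ => 0, fun _ => 0, μ, fun _ => 0]

/-- See `baseCoeff`. -/
def baseCoeff' (μ : Plane → ℂ) : Fin 6 → Plane → ℂ :=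
  ![fun _ => 0, fun _ => 1, fun _ => 0, fun _ => 0, fun _ => 0, μ]

theorem kills_base (μ : Plane → ℂ) : k.Kills (c.singularSystem μ) 1 0 (baseCoeff μ) := by
  intro α hα z hz
  have hy := hz.1
  refine ev_eq_zero_of_mem_singularSystem c hα hz _ ?_ ?_ ?_ ?_ ?_ ?_ <;>
    simp [coeff, baseCoeff, k.η₁_X _ hy, k.η₂_X _ hy]

theorem kills_base' (μ : Plane → ℂ) : k.Kills (c.singularSystem μ) 0 1 (baseCoeff' μ) := by
  intro α hα z hz
  have hy := hz.1
  refine ev_eq_zero_of_mem_singularSystem c hα hz _ ?_ ?_ ?_ ?_ ?_ ?_ <;>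
    simp [coeff, baseCoeff', k.η₁_X' _ hy, k.η₂_X' _ hy]

theorem base_eq {μ : Plane → ℂ} {α : Amb → Amb →L[ℝ] ℂ} (hα : α ∈ c.singularSystem μ) {z : Amb}
    (hz : z ∈ frameDomain U) : k.horiz (α z) z 0 + k.vert (α z) z 0 + μ z.1 * k.vert (α z) z 4 = 0
      ∧ k.horiz (α z) z 1 + k.vert (α z) z 1 + μ z.1 * k.vert (α z) z 5 = 0 := by
  have h := (k.kills_iff _ _ _ _).1 (k.kills_base μ) α hα z hz
  have h' := (k.kills_iff _ _ _ _).1 (k.kills_base' μ) α hα z hz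
  simp only [Fin.sum_univ_six, baseCoeff, baseCoeff', Matrix.cons_val, Complex.ofReal_one,
    Complex.ofReal_zero] at h h'
  exact ⟨by linear_combination h, by linear_combination h'⟩

theorem vert_congr {z : Amb} (hz : z ∈ frameDomain U) {α β : Amb →L[ℝ] ℂ}
    (h : ∀ v ∈ frameTangent z, α v = β v) : k.vert α z = k.vert β z := by
  simp only [vert, h _ (motion_mem_frameTangent hz _)]

theorem horiz_congr {z : Amb} (hz : z ∈ frameDomain U) {α β : Amb →L[ℝ] ℂ}
    (h : ∀ v ∈ frameTangent z, α v = β v) : k.horiz α z = k.horiz β z := by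
  simp only [horiz, h _ (motion_mem_frameTangent hz _), h _ (horizontal_mem_frameTangent z _)]

theorem vert_add (α β : Amb →L[ℝ] ℂ) (z : Amb) (i : Fin 6) :
    k.vert (α + β) z i = k.vert α z i + k.vert β z i := by
  fin_cases i <;> simp [vert] <;> ring

theorem horiz_add (α β : Amb →L[ℝ] ℂ) (z : Amb) (i : Fin 2) :
    k.horiz (α + β) z i = k.horiz α z i + k.horiz β z i := by
  fin_cases i <;> simp [horiz] <;> ring

/-- The final derived system of one singular system is transverse to the other one, so that it
does not annihilate any combination of `L` and `L'`. -/
theorem eq_zero_of_forall_finalDerived (hc : c.IsEllipticDarbouxIntegrable) {z : Amb}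
    (hz : z ∈ frameDomain U) {p q : ℂ}
    (h : ∀ β ∈ finalDerived (frameDomain U) frameTangent
        (c.singularSystem fun y => Complex.I * (Real.sqrt (c.K y) : ℂ)),
      p * k.vert (β z) z 4 + q * k.vert (β z) z 5 = 0) : p = 0 ∧ q = 0 := by
  -- Split the pull-back of `η` as `α + β` with `α` in the conjugate system and `β` in `W^∞`. The
  -- combination with coefficients `p, q` of the conjugates of `P, P'` is killed by `α`; it is
  -- killed by `β` because it differs from that of `P, P'` by a multiple of `p L + q L'`. Only the
  -- value of `η` on `p X + q X'` is left.
  have key : ∀ η : Plane → Plane →L[ℝ] ℝ,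
      p * (η z.1 (k.X z.1) : ℂ) + q * (η z.1 (k.X' z.1) : ℂ) = 0 := by
    intro η
    obtain ⟨α, hα, β, hβ, hγ⟩ := hc.2.spans₂ z hz (toC (pullPlane η z))
    have hγ' : ∀ v ∈ frameTangent z, toC (pullPlane η z) v = (α z + β z) v := hγ
    have hα' := k.base_eq hα hz
    have hβ' := k.base_eq (derivedFlag_subset U _ 0 (finalDerived_subset U _ 0 hβ)) hz
    have hv := k.vert_congr hz hγ'
    have hh := k.horiz_congr hz hγ'
    have hv0 : ∀ i, k.vert (α z) z i + k.vert (β z) z i = 0 := fun i => by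
      rw [← vert_add, ← hv]
      fin_cases i <;> simp [vert, toC_apply, pullPlane, motion_fst]
    have hh0 : k.horiz (α z) z 0 + k.horiz (β z) z 0 = η z.1 (k.X z.1) := by
      rw [← horiz_add, ← hh]
      simp [horiz, toC_apply, pullPlane, motion_fst]
    have hh1 : k.horiz (α z) z 1 + k.horiz (β z) z 1 = η z.1 (k.X' z.1) := by
      rw [← horiz_add, ← hh]
      simp [horiz, toC_apply, pullPlane, motion_fst]
    rw [← hh0, ← hh1]
    have e4 := hv0 4
    have e5 := hv0 5
    have e0 := hv0 0
    have e1 := hv0 1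
    have hpq := h β hβ
    obtain ⟨a1, a2⟩ := hα'
    obtain ⟨b1, b2⟩ := hβ'
    linear_combination p * a1 + q * a2 + p * b1 + q * b2 - p * e0 - q * e1
      + Complex.I * (Real.sqrt (c.K z.1) : ℂ) * (p * e4 + q * e5)
      - 2 * Complex.I * (Real.sqrt (c.K z.1) : ℂ) * hpq
  have h1 := key c.η₁
  have h2 := key c.η₂
  rw [k.η₁_X _ hz.1, k.η₁_X' _ hz.1] at h1
  rw [k.η₂_X _ hz.1, k.η₂_X' _ hz.1] at h2
  -- Determinant of the two equations in `p`, `q`: `X` and `X'` are independent because `X` is not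
  -- null.
  have hN : ((k.x₂ z.1 : ℂ) ^ 2 - (k.x₁ z.1 : ℂ) ^ 2) ≠ 0 := by
    have := k.spacelike z.1 hz.1
    exact_mod_cast (sub_pos.2 this).ne'
  constructor
  · exact (mul_eq_zero.1 (by linear_combination k.x₂ z.1 * h2 - k.x₁ z.1 * h1 :
      p * ((k.x₂ z.1 : ℂ) ^ 2 - (k.x₁ z.1 : ℂ) ^ 2) = 0)).resolve_right hN
  · exact (mul_eq_zero.1 (by linear_combination k.x₂ z.1 * h1 - k.x₁ z.1 * h2 :
      q * ((k.x₂ z.1 : ℂ) ^ 2 - (k.x₁ z.1 : ℂ) ^ 2) = 0)).resolve_right hN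

end KillingFrame
-- Calculus of functions constant along the Killing field
namespace KillingFrame

variable {U : Set Plane} {c : CartanFrame U} (k : KillingFrame c)

/-- Smooth functions that are constant along the Killing field. -/
structure Invariant (h : Plane → ℂ) : Prop where
  smooth : ContDiffOn ℝ ∞ h U
  fderiv_X : ∀ y ∈ U, fderiv ℝ h y (k.X y) = 0

/-- Derivative along the field orthogonal to the Killing field. -/
noncomputable def D (h : Plane → ℂ) (y : Plane) : ℂ := fderiv ℝ h y (k.X' y)

variable {k}

theorem Invariant.differentiableAt (hU : IsOpen U) {h : Plane → ℂ} (hh : k.Invariant h) {y : Plane}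
    (hy : y ∈ U) : DifferentiableAt ℝ h y :=
  differentiableAt_of_contDiffOn hU hh.smooth hy

theorem Invariant.const (r : ℂ) : k.Invariant fun _ => r :=
  ⟨contDiffOn_const, fun y _ => by simp⟩

theorem D_const (r : ℂ) (y : Plane) : k.D (fun _ => r) y = 0 := by
  simp [D]

theorem Invariant.neg {h : Plane → ℂ} (hh : k.Invariant h) : k.Invariant fun y => -h y :=
  ⟨hh.smooth.neg, fun y hy => by simp [fderiv_fun_neg, hh.fderiv_X y hy]⟩

theorem D_neg (h : Plane → ℂ) (y : Plane) : k.D (fun y => -h y) y = -k.D h y := by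
  simp [D, fderiv_fun_neg]

theorem Invariant.add (hU : IsOpen U) {h j : Plane → ℂ} (hh : k.Invariant h)
    (hj : k.Invariant j) : k.Invariant fun y => h y + j y :=
  ⟨hh.smooth.add hj.smooth, fun y hy => by
    rw [fderiv_fun_add (hh.differentiableAt hU hy) (hj.differentiableAt hU hy)]
    simp [hh.fderiv_X y hy, hj.fderiv_X y hy]⟩

theorem Invariant.sub (hU : IsOpen U) {h j : Plane → ℂ} (hh : k.Invariant h)
    (hj : k.Invariant j) : k.Invariant fun y => h y - j y := by
  simpa only [sub_eq_add_neg] using hh.add hU hj.neg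

theorem Invariant.mul (hU : IsOpen U) {h j : Plane → ℂ} (hh : k.Invariant h)
    (hj : k.Invariant j) : k.Invariant fun y => h y * j y :=
  ⟨hh.smooth.mul hj.smooth, fun y hy => by
    rw [fderiv_fun_mul (hh.differentiableAt hU hy) (hj.differentiableAt hU hy)]
    simp [hh.fderiv_X y hy, hj.fderiv_X y hy]⟩

theorem Invariant.div (hU : IsOpen U) {h j : Plane → ℂ} (hh : k.Invariant h)
    (hj : k.Invariant j) (h0 : ∀ y ∈ U, j y ≠ 0) : k.Invariant fun y => h y / j y := by
  have hs : ContDiffOn ℝ ∞ (fun y => h y / j y) U := by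
    simp only [div_eq_mul_inv]
    exact hh.smooth.mul (hj.smooth.inv h0)
  refine ⟨hs, fun y hy => ?_⟩
  have he : (fun z => h z / j z * j z) =ᶠ[nhds y] h := by
    filter_upwards [hU.mem_nhds hy] with z hz using div_mul_cancel₀ _ (h0 z hz)
  have h1 := he.fderiv_eq (𝕜 := ℝ)
  rw [fderiv_fun_mul (differentiableAt_of_contDiffOn hU hs hy) (hj.differentiableAt hU hy)] at h1
  have h2 := congrArg (fun F => F (k.X y)) h1
  simpa [hh.fderiv_X y hy, hj.fderiv_X y hy, h0 y hy] using h2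

/-- `X(X' h) = X'(X h) = 0` because `X` and `X'` commute. This keeps all iterated brackets inside
the class of fields with invariant coefficients. -/
theorem Invariant.deriv (hU : IsOpen U) {h : Plane → ℂ} (hh : k.Invariant h) :
    k.Invariant (k.D h) := by
  have hs : ContDiffOn ℝ ∞ (fderiv ℝ h) U := hh.smooth.fderiv_of_isOpen hU (by simp)
  refine ⟨hs.clm_apply k.smooth_X', fun y hy => ?_⟩
  have hf := (differentiableAt_of_contDiffOn hU hs hy).hasFDerivAt
  have e' := hf.clm_apply (differentiableAt_of_contDiffOn hU k.smooth_X' hy).hasFDerivAt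
  have e := hf.clm_apply (differentiableAt_of_contDiffOn hU k.smooth_X hy).hasFDerivAt
  have h0 : (fun z => fderiv ℝ h z (k.X z)) =ᶠ[nhds y] fun _ => 0 := by
    filter_upwards [hU.mem_nhds hy] with z hz using hh.fderiv_X z hz
  have e0 := e.unique ((hasFDerivAt_const (0 : ℂ) y).congr_of_eventuallyEq h0)
  have e1 := congrArg (fun F => F (k.X' y)) e0
  have hsymm := (hh.smooth.contDiffAt (hU.mem_nhds hy)).isSymmSndFDerivAt
    (by simpa using WithTop.coe_le_coe.2 (le_top (a := (2 : ℕ∞))))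
  change fderiv ℝ (fun z => fderiv ℝ h z (k.X' z)) y (k.X y) = 0
  rw [e'.fderiv]
  simp only [add_apply, ContinuousLinearMap.comp_apply,
    ContinuousLinearMap.flip_apply, zero_apply] at e1 ⊢
  rw [k.commute y hy, hsymm, e1]

theorem Invariant.ofReal (hU : IsOpen U) {h : Plane → ℝ} (hh : ContDiffOn ℝ ∞ h U)
    (h0 : ∀ y ∈ U, fderiv ℝ h y (k.X y) = 0) : k.Invariant fun y => (h y : ℂ) :=
  ⟨Complex.ofRealCLM.contDiff.comp_contDiffOn hh, fun y hy => by
    rw [(hasFDerivAt_ofReal (differentiableAt_of_contDiffOn hU hh hy)).fderiv]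
    simp [h0 y hy]⟩

theorem D_ofReal (hU : IsOpen U) {h : Plane → ℝ} (hh : ContDiffOn ℝ ∞ h U) {y : Plane}
    (hy : y ∈ U) : k.D (fun y => (h y : ℂ)) y = (fderiv ℝ h y (k.X' y) : ℝ) := by
  rw [D, (hasFDerivAt_ofReal (differentiableAt_of_contDiffOn hU hh hy)).fderiv]
  simp

variable (k)

theorem smooth_N : ContDiffOn ℝ ∞ k.N U := (k.smooth_x₂.pow 2).sub (k.smooth_x₁.pow 2)

theorem N_pos {y : Plane} (hy : y ∈ U) : 0 < k.N y := sub_pos.2 (k.spacelike y hy)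

theorem fderiv_N (hU : IsOpen U) {y : Plane} (hy : y ∈ U) (v : Plane) :
    fderiv ℝ k.N y v = 2 * k.f y * (k.x₂ y * c.η₁ y v - k.x₁ y * c.η₂ y v) := by
  have d₁ := (differentiableAt_of_contDiffOn hU k.smooth_x₁ hy).hasFDerivAt
  have d₂ := (differentiableAt_of_contDiffOn hU k.smooth_x₂ hy).hasFDerivAt
  have : HasFDerivAt k.N _ y := (d₂.pow 2).sub (d₁.pow 2)
  rw [this.fderiv]
  simp [k.d_x₁ y hy, k.d_x₂ y hy]
  ring

theorem fderiv_N_X (hU : IsOpen U) {y : Plane} (hy : y ∈ U) : fderiv ℝ k.N y (k.X y) = 0 := by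
  rw [k.fderiv_N hU hy, k.η₁_X y hy, k.η₂_X y hy]
  ring

theorem fderiv_f_X {y : Plane} (hy : y ∈ U) : fderiv ℝ k.f y (k.X y) = 0 := by
  rw [k.d_f y hy, k.η₁_X y hy, k.η₂_X y hy]
  ring

theorem fderiv_f_X' {y : Plane} (hy : y ∈ U) : fderiv ℝ k.f y (k.X' y) = -(c.K y * k.N y) := by
  rw [k.d_f y hy, k.η₁_X' y hy, k.η₂_X' y hy, N]
  ring

/-- The Gauss curvature is constant along the Killing field. -/
theorem fderiv_K_X (hU : IsOpen U) {y : Plane} (hy : y ∈ U) : fderiv ℝ c.K y (k.X y) = 0 := by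
  -- The derivative of `f` along `X'` is `-K N`; it is invariant, and so is `N > 0`, hence also `K`.
  have hf := (Invariant.ofReal hU k.smooth_f fun y hy => k.fderiv_f_X hy).deriv hU
  have hKN : HasFDerivAt (fun z => -(c.K z * k.N z)) _ y :=
    ((differentiableAt_of_contDiffOn hU c.smooth_K hy).hasFDerivAt.mul
      (differentiableAt_of_contDiffOn hU k.smooth_N hy).hasFDerivAt).neg
  have he : k.D (fun y => (k.f y : ℂ)) =ᶠ[nhds y] fun z => ((-(c.K z * k.N z) : ℝ) : ℂ) := by
    filter_upwards [hU.mem_nhds hy] with z hz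
    rw [D_ofReal hU k.smooth_f hz, k.fderiv_f_X' hz]
  have h0 := hf.fderiv_X y hy
  rw [he.fderiv_eq, (hasFDerivAt_ofReal hKN.differentiableAt).fderiv, hKN.fderiv] at h0
  simp [k.fderiv_N_X hU hy, (k.N_pos hy).ne'] at h0
  exact h0

theorem kills_succ {S : Set (Amb → Amb →L[ℝ] ℂ)} {n : ℕ} {s t : ℝ} {ξ : Fin 6 → Plane → ℂ}
    (h : k.Kills (derivedFlag U S n) s t ξ) : k.Kills (derivedFlag U S (n + 1)) s t ξ :=
  fun α hα => h α (derivedFlag_succ_subset U S n hα)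

theorem kills_bracket (hU : IsOpen U) {μ : Plane → ℂ} {n : ℕ} {s t s' t' : ℝ}
    {ξ η : Fin 6 → Plane → ℂ} (hA : k.Kills (derivedFlag U (c.singularSystem μ) n) s t ξ)
    (hB : k.Kills (derivedFlag U (c.singularSystem μ) n) s' t' η)
    (hξ : ∀ i, k.Invariant (ξ i)) (hη : ∀ i, k.Invariant (η i)) :
    k.Kills (derivedFlag U (c.singularSystem μ) (n + 1)) 0 0
      (k.bracketCoeff s t ξ (fun i => k.D (ξ i)) s' t' η (fun i => k.D (η i))) := by
  rw [derivedFlag_succ]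
  exact Kills.bracket k hU (fun α hα => (derivedFlag_subset U _ n hα).1) hA hB
    (fun y hy i => (hξ i).differentiableAt hU hy) (fun y hy i => (hη i).differentiableAt hU hy)
    (fun y hy i => (hξ i).fderiv_X y hy) (fun y hy i => (hη i).fderiv_X y hy)
    (fun y hy i => rfl) (fun y hy i => rfl)

/-! ### The differential equation for the curvature -/

/-- Elimination of `a` and `e` from the bracket relations. If `m = 0`, they give `e = μ/2`, `a = μ`
and then `μ⁴ = 0`. Otherwise, after division by `2μ` and `mN`, what remains is the perfect square
`(m f - μ²)² = 0`. -/
theorem eq_sq_of_bracket_relations {μ N m f a e : ℂ} (hμ : μ ≠ 0) (hN : N ≠ 0)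
    (he : 2 * μ * e = μ ^ 2 - m * f) (h₁ : a * f + m * N * μ = e * (f + m * N))
    (h₂ : e * (a + μ) - μ * a - m ^ 2 * N = 0)
    (h₃ : 2 * m * μ * (f * (e - a) + (e + μ) * N * m)
      + (f * m + μ ^ 2) * (a * e + μ * a - μ * e - m ^ 2 * N) = 0) : m * f = μ ^ 2 := by
  by_cases hm : m = 0
  · subst hm
    exfalso
    have e1 : e = μ / 2 := by
      field_simp
      exact mul_left_cancel₀ hμ (by linear_combination he)
    subst e1
    have a1 : a = μ := mul_left_cancel₀ hμ (by linear_combination -2 * h₂)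
    subst a1
    exact pow_ne_zero 4 hμ (by linear_combination h₃)
  · have h4 : 2 * μ * m ^ 2 * N + (f * m + μ ^ 2) * (a - e) = 0 := by
      refine (mul_eq_zero.1 (?_ : (2 * μ) * _ = 0)).resolve_left (by simp [hμ])
      linear_combination h₃ + 2 * m * μ * h₁ - (f * m + μ ^ 2) * h₂
    have h5 : 2 * μ * m * f + (f * m + μ ^ 2) * (e - μ) = 0 := by
      refine (mul_eq_zero.1 (?_ : (m * N) * _ = 0)).resolve_left (by simp [hm, hN])
      linear_combination f * h4 - (f * m + μ ^ 2) * h₁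
    have h6 : (m * f - μ ^ 2) ^ 2 = 0 := by
      linear_combination -(2 * μ) * h5 + (f * m + μ ^ 2) * he
    exact sub_eq_zero.1 (pow_eq_zero_iff two_ne_zero |>.1 h6)

end KillingFrame

/-- The bracket relations involve only functions on the base; to read them at `y`, some frame over
`y` is needed. -/
theorem exists_mem_frameDomain {U : Set Plane} {y : Plane} (hy : y ∈ U) :
    ∃ z ∈ frameDomain U, z.1 = y := by
  refine ⟨(y, 0, (1 : Matrix (Fin 3) (Fin 3) ℝ)), ⟨hy, fun i j => ?_, ?_⟩, rfl⟩
  · rw [mink_apply]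
    fin_cases i <;> fin_cases j <;> simp [sgn, Matrix.one_apply]
  · exact Matrix.det_one

namespace KillingFrame

variable {U : Set Plane} {c : CartanFrame U} (k : KillingFrame c)

/-- The heart of the proof: the vanishing of every combination of `L` and `L'` in the third round of
brackets forces `m f = μ²`, which is this equation rewritten with `μ² = -K` and `X' μ = 2μNm`. -/
theorem f_mul_fderiv_K (hU : IsOpen U) (hc : c.IsEllipticDarbouxIntegrable) {y : Plane}
    (hy : y ∈ U) : k.f y * fderiv ℝ c.K y (k.X' y) = -4 * c.K y ^ 2 * k.N y := by
  have hK := hc.1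
  have hκs : ContDiffOn ℝ ∞ (fun y => Real.sqrt (c.K y)) U :=
    c.smooth_K.sqrt fun y hy => (hK y hy).ne'
  have hκ' : ∀ y ∈ U, ∀ v, fderiv ℝ (fun y => Real.sqrt (c.K y)) y v
      = fderiv ℝ c.K y v / (2 * Real.sqrt (c.K y)) := by
    intro y hy v
    rw [((differentiableAt_of_contDiffOn hU c.smooth_K hy).hasFDerivAt.sqrt (hK y hy).ne').fderiv]
    simp
    ring
  have hκ0 : ∀ y ∈ U, (Real.sqrt (c.K y) : ℂ) ≠ 0 := fun y hy => by
    exact_mod_cast (Real.sqrt_pos.2 (hK y hy)).ne'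
  have hN0 : ∀ y ∈ U, (k.N y : ℂ) ≠ 0 := fun y hy => by exact_mod_cast (k.N_pos hy).ne'
  have hμK : ∀ y ∈ U, (Complex.I * (Real.sqrt (c.K y) : ℂ)) ^ 2 = -(c.K y : ℂ) := fun y hy => by
    rw [mul_pow, Complex.I_sq, ← Complex.ofReal_pow, Real.sq_sqrt (hK y hy).le]
    ring
  have iκ : k.Invariant fun y => (Real.sqrt (c.K y) : ℂ) := Invariant.ofReal hU hκs fun y hy => by
    rw [hκ' y hy, k.fderiv_K_X hU hy, zero_div]
  have i_f : k.Invariant fun y => (k.f y : ℂ) :=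
    Invariant.ofReal hU k.smooth_f fun y hy => k.fderiv_f_X hy
  have iN : k.Invariant fun y => (k.N y : ℂ) :=
    Invariant.ofReal hU k.smooth_N fun y hy => k.fderiv_N_X hU hy
  have iμ : k.Invariant fun y => Complex.I * (Real.sqrt (c.K y) : ℂ) :=
    (Invariant.const _).mul hU iκ
  have hμ0 : ∀ y ∈ U, Complex.I * (Real.sqrt (c.K y) : ℂ) ≠ 0 := fun y hy => by
    simp [hκ0 y hy]
  have hDμ : k.D (fun y => Complex.I * (Real.sqrt (c.K y) : ℂ)) y
      = Complex.I * ((fderiv ℝ c.K y (k.X' y) / (2 * Real.sqrt (c.K y)) : ℝ) : ℂ) := by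
    have d : DifferentiableAt ℝ (fun y => (Real.sqrt (c.K y) : ℂ)) y := iκ.differentiableAt hU hy
    rw [D, fderiv_const_mul d, smul_apply, smul_eq_mul, ← hκ' y hy, ← D_ofReal hU hκs hy]
    rfl
  suffices hmain : (k.f y : ℂ) * k.D (fun y => Complex.I * (Real.sqrt (c.K y) : ℂ)) y
      = 2 * (Complex.I * (Real.sqrt (c.K y) : ℂ)) ^ 3 * k.N y by
    rw [hDμ, pow_succ, hμK y hy] at hmain
    have h1 : Complex.I * ((k.f y * (fderiv ℝ c.K y (k.X' y) / (2 * Real.sqrt (c.K y))) : ℝ) : ℂ)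
        = Complex.I * ((-2 * c.K y * Real.sqrt (c.K y) * k.N y : ℝ) : ℂ) := by
      push_cast at hmain ⊢
      linear_combination hmain
    have h2 := Complex.ofReal_injective (mul_left_cancel₀ Complex.I_ne_zero h1)
    have hs := (Real.sqrt_pos.2 (hK y hy)).ne'
    have hs2 := Real.sq_sqrt (hK y hy).le
    field_simp at h2
    linear_combination h2 - 4 * c.K y * k.N y * hs2
  -- From here on only the invariance of `μ`, `μ ≠ 0` and `μ² = -K` matter.
  generalize hμdef : (fun y => Complex.I * (Real.sqrt (c.K y) : ℂ)) = μ at iμ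
  have hμ0' : ∀ y ∈ U, μ y ≠ 0 := by simpa only [← hμdef] using hμ0
  have hμK' : ∀ y ∈ U, μ y ^ 2 = -(c.K y : ℂ) := by simpa only [← hμdef] using hμK
  rw [show Complex.I * (Real.sqrt (c.K y) : ℂ) = μ y from congrFun hμdef y]
  have hden : ∀ y ∈ U, 2 * μ y * (k.N y : ℂ) ≠ 0 := fun y hy => by simp [hμ0' y hy, hN0 y hy]
  have hden2 : ∀ y ∈ U, 2 * μ y ≠ 0 := fun y hy => by simp [hμ0' y hy]
  have i2μ : k.Invariant fun y => 2 * μ y := (Invariant.const 2).mul hU iμ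
  -- The coefficients `m`, `e`, `a` are read off from the brackets: `[P, P'] = 2μN Z`, `[P, Z] = 2μ
  -- Q'` and `[P', Z] = 2μ Q + mN Z`.
  obtain ⟨m, im, hm⟩ : ∃ m, k.Invariant m ∧ ∀ y ∈ U, k.D μ y = 2 * μ y * k.N y * m y :=
    ⟨_, (iμ.deriv hU).div hU (i2μ.mul hU iN) hden, fun y hy => (mul_div_cancel₀ _ (hden y hy)).symm⟩
  obtain ⟨e, ie, he⟩ : ∃ e, k.Invariant e ∧ ∀ y ∈ U, 2 * μ y * e y = μ y * μ y - m y * k.f y :=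
    ⟨_, ((iμ.mul hU iμ).sub hU (im.mul hU i_f)).div hU i2μ hden2, fun y hy => (mul_div_cancel₀ _ (hden2 y hy))⟩
  obtain ⟨a, ia, ha⟩ : ∃ a, k.Invariant a ∧ ∀ y ∈ U,
      2 * μ y * a y = μ y * μ y - m y * k.f y - k.D m y + m y * m y * k.N y :=
    ⟨_, ((((iμ.mul hU iμ).sub hU (im.mul hU i_f)).sub hU (im.deriv hU)).add hU
      ((im.mul hU im).mul hU iN)).div hU i2μ hden2, fun y hy => (mul_div_cancel₀ _ (hden2 y hy))⟩
  have i0 : k.Invariant fun _ => 0 := Invariant.const 0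
  have i1 : k.Invariant fun _ => 1 := Invariant.const 1
  have iP : ∀ i, k.Invariant (baseCoeff μ i) := by
    intro i
    fin_cases i <;> simp [baseCoeff, i0, i1, iμ]
  have iP' : ∀ i, k.Invariant (baseCoeff' μ i) := by
    intro i
    fin_cases i <;> simp [baseCoeff', i0, i1, iμ]
  let Z : Fin 6 → Plane → ℂ :=
    ![fun _ => 0, fun _ => 0, fun _ => 1, fun y => -μ y, fun y => -m y, fun _ => 0]
  let Q : Fin 6 → Plane → ℂ :=
    ![fun _ => 1, fun _ => 0, fun _ => 0, fun y => -(m y * k.N y), a, fun _ => 0]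
  let Q' : Fin 6 → Plane → ℂ :=
    ![fun _ => 0, fun _ => 1, fun _ => 0, fun _ => 0, fun _ => 0, e]
  have iZ : ∀ i, k.Invariant (Z i) := by
    intro i
    fin_cases i <;> simp [Z, i0, i1, iμ.neg, im.neg]
  have iQ : ∀ i, k.Invariant (Q i) := by
    intro i
    fin_cases i <;> simp [Q, i0, i1, (im.mul hU iN).neg, ia]
  have iQ' : ∀ i, k.Invariant (Q' i) := by
    intro i
    fin_cases i <;> simp [Q', i0, i1, ie]
  have kP : k.Kills (derivedFlag U (c.singularSystem μ) 0) 1 0 (baseCoeff μ) := k.kills_base μ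
  have kP' : k.Kills (derivedFlag U (c.singularSystem μ) 0) 0 1 (baseCoeff' μ) := k.kills_base' μ
  have D0 := D_const (k := k) 0
  have D1 := D_const (k := k) 1
  have kZ : k.Kills (derivedFlag U (c.singularSystem μ) 1) 0 0 Z := by
    have hb := k.kills_bracket hU kP kP' iP iP'
    rw [kills_iff] at hb ⊢
    intro α hα z hz
    have h := hb α hα z hz
    simp only [Fin.sum_univ_six, bracketCoeff, baseCoeff, baseCoeff', Matrix.cons_val, D0, D1,
      hm z.1 hz.1, Z] at h ⊢
    refine (mul_eq_zero.1 (?_ : (2 * μ z.1 * (k.N z.1 : ℂ)) * _ = 0)).resolve_left (hden _ hz.1)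
    push_cast at h ⊢
    linear_combination h - k.N z.1 * k.vert (α z) z 3 * hμK' z.1 hz.1
  have kP1 := k.kills_succ kP
  have kP1' := k.kills_succ kP'
  have kQ' : k.Kills (derivedFlag U (c.singularSystem μ) 2) 0 0 Q' := by
    have hb := k.kills_bracket hU kP1 kZ iP iZ
    rw [kills_iff] at hb ⊢
    intro α hα z hz
    have h := hb α hα z hz
    simp only [Fin.sum_univ_six, bracketCoeff, baseCoeff, Matrix.cons_val, Z, Q'] at h ⊢
    refine (mul_eq_zero.1 (?_ : (2 * μ z.1) * _ = 0)).resolve_left (hden2 _ hz.1)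
    push_cast at h ⊢
    linear_combination h + k.vert (α z) z 5 * he z.1 hz.1
  have kZ2 := k.kills_succ kZ
  have kQ : k.Kills (derivedFlag U (c.singularSystem μ) 2) 0 0 Q := by
    have hb := k.kills_bracket hU kP1' kZ iP' iZ
    rw [kills_iff] at hb kZ2 ⊢
    intro α hα z hz
    have h := hb α hα z hz
    have h' := kZ2 α hα z hz
    simp only [Fin.sum_univ_six, bracketCoeff, baseCoeff', Matrix.cons_val, Z, Q, D0, D1, D_neg,
      hm z.1 hz.1] at h h' ⊢
    refine (mul_eq_zero.1 (?_ : (2 * μ z.1) * _ = 0)).resolve_left (hden2 _ hz.1)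
    push_cast at h h' ⊢
    linear_combination h + k.vert (α z) z 4 * ha z.1 hz.1 - m z.1 * k.N z.1 * h'
  have kP2 := k.kills_succ kP1
  -- Brackets with `P'` are avoided in this round: `P` points along `X` and `Z, Q, Q'` are vertical,
  -- so no derivatives of `a`, `e`, `m` appear and the relations are algebraic.
  have kPQ := k.kills_bracket hU kP2 kQ iP iQ
  have kPQ' := k.kills_bracket hU kP2 kQ' iP iQ'
  have kZQ := k.kills_bracket hU kZ2 kQ iZ iQ
  have kZQ' := k.kills_bracket hU kZ2 kQ' iZ iQ'
  have kZ3 := k.kills_succ kZ2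
  have kQ3 := k.kills_succ kQ
  have kQ3' := k.kills_succ kQ'
  rw [kills_iff] at kPQ kPQ' kZQ kZQ' kZ3 kQ3 kQ3'
  obtain ⟨z, hz, rfl⟩ := exists_mem_frameDomain hy
  rw [hm z.1 hy]
  have rel : m z.1 * k.f z.1 = μ z.1 ^ 2 := by
    have fin : ∀ β ∈ finalDerived (frameDomain U) frameTangent (c.singularSystem μ),
        β ∈ derivedFlag U (c.singularSystem μ) 3 := fun β hβ => finalDerived_subset U _ 3 hβ
    have nd := fun {p q : ℂ} => k.eq_zero_of_forall_finalDerived hc hz (p := p) (q := q)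
    rw [hμdef] at nd
    refine eq_sq_of_bracket_relations (a := a z.1) (e := e z.1) (hμ0' _ hy) (hN0 _ hy)
      (by rw [he z.1 hy, sq]) ?_ ?_ ?_
    -- Modulo `Q'`, the bracket `[P, Q]` is a multiple of `L'`.
    · have := nd (p := 0) (q := a z.1 * k.f z.1 + m z.1 * k.N z.1 * μ z.1
        - e z.1 * (k.f z.1 + m z.1 * k.N z.1)) fun β hβ => by
          have h1 := kPQ (β) (fin β hβ) z hz
          have h2 := kQ3' (β) (fin β hβ) z hz
          simp only [Fin.sum_univ_six, bracketCoeff, baseCoeff, Matrix.cons_val, Q, Q'] at h1 h2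
          push_cast at h1 h2
          linear_combination h1 - (k.f z.1 + m z.1 * k.N z.1) * h2
      exact sub_eq_zero.1 this.2
    -- Modulo `Q'`, the bracket `[Z, Q]` is a multiple of `L'`.
    · have := nd (p := 0) (q := e z.1 * (a z.1 + μ z.1) - μ z.1 * a z.1
        - m z.1 ^ 2 * k.N z.1) fun β hβ => by
          have h1 := kZQ (β) (fin β hβ) z hz
          have h2 := kQ3' (β) (fin β hβ) z hz
          simp only [Fin.sum_univ_six, bracketCoeff, Matrix.cons_val, Z, Q, Q'] at h1 h2
          push_cast at h1 h2
          linear_combination h1 + (a z.1 + μ z.1) * h2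
      exact this.2
    -- Modulo `Q` and `Z`, both `[P, Q']` and `[Z, Q']` are combinations of `L₁₂` and `L`;
    -- eliminating `L₁₂` leaves a multiple of `L`.
    · have := nd (q := 0) (p := 2 * m z.1 * μ z.1 * (k.f z.1 * (e z.1 - a z.1)
          + (e z.1 + μ z.1) * k.N z.1 * m z.1)
        + (k.f z.1 * m z.1 + μ z.1 ^ 2) * (a z.1 * e z.1 + μ z.1 * a z.1 - μ z.1 * e z.1
          - m z.1 ^ 2 * k.N z.1)) fun β hβ => by
          have h1 := kPQ' (β) (fin β hβ) z hz
          have h2 := kZQ' (β) (fin β hβ) z hz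
          have h3 := kZ3 (β) (fin β hβ) z hz
          have h4 := kQ3 (β) (fin β hβ) z hz
          simp only [Fin.sum_univ_six, bracketCoeff, baseCoeff, Matrix.cons_val, Z, Q, Q']
            at h1 h2 h3 h4
          push_cast at h1 h2 h3 h4
          have h1' : k.N z.1 * (k.f z.1 * m z.1 + μ z.1 ^ 2) * k.vert (β z) z 3
              + (k.f z.1 * (e z.1 - a z.1) + (e z.1 + μ z.1) * k.N z.1 * m z.1)
                * k.vert (β z) z 4 = 0 := by
            linear_combination h1 - k.f z.1 * h4 - (e z.1 + μ z.1) * k.N z.1 * h3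
          have h2' : -(2 * μ z.1 * m z.1 * k.N z.1) * k.vert (β z) z 3
              + (a z.1 * e z.1 + μ z.1 * a z.1 - μ z.1 * e z.1 - m z.1 ^ 2 * k.N z.1)
                * k.vert (β z) z 4 = 0 := by
            linear_combination h2 + (e z.1 + μ z.1) * h4 + m z.1 * k.N z.1 * h3
          linear_combination 2 * m z.1 * μ z.1 * h1' + (k.f z.1 * m z.1 + μ z.1 ^ 2) * h2'
      exact this.1
  linear_combination 2 * μ z.1 * k.N z.1 * rel

end KillingFrame

/-! ### From the Killing equation to a Killing frame -/

theorem contDiffOn_fderiv_apply {E F : Type*} [NormedAddCommGroup E] [NormedSpace ℝ E]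
    [NormedAddCommGroup F] [NormedSpace ℝ F] {U : Set E} (hU : IsOpen U) {h : E → F} {V : E → E}
    (hh : ContDiffOn ℝ ∞ h U) (hV : ContDiffOn ℝ ∞ V U) :
    ContDiffOn ℝ ∞ (fun y => fderiv ℝ h y (V y)) U :=
  (hh.fderiv_of_isOpen hU (by simp)).clm_apply hV

theorem fderiv_fderiv_symm {E F : Type*} [NormedAddCommGroup E] [NormedSpace ℝ E]
    [NormedAddCommGroup F] [NormedSpace ℝ F] {U : Set E} (hU : IsOpen U) {h : E → F}
    (hh : ContDiffOn ℝ ∞ h U) {y : E} (hy : y ∈ U) (v w : E) :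
    fderiv ℝ (fderiv ℝ h) y v w = fderiv ℝ (fderiv ℝ h) y w v :=
  (hh.contDiffAt (hU.mem_nhds hy)).isSymmSndFDerivAt
    (by simpa using WithTop.coe_le_coe.2 (le_top (a := (2 : ℕ∞)))) v w

namespace CartanFrame

variable {U : Set Plane} (c : CartanFrame U)

/-- The determinant of the coframing in the standard basis. -/
noncomputable def det (y : Plane) : ℝ :=
  c.η₁ y (EuclideanSpace.single 0 1) * c.η₂ y (EuclideanSpace.single 1 1)
    - c.η₁ y (EuclideanSpace.single 1 1) * c.η₂ y (EuclideanSpace.single 0 1)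

/-- The vector with given components in the framing. -/
noncomputable def vec (s t : ℝ) (y : Plane) : Plane :=
  ((s * c.η₂ y (EuclideanSpace.single 1 1) - t * c.η₁ y (EuclideanSpace.single 1 1)) / c.det y) •
      EuclideanSpace.single 0 1
    + ((t * c.η₁ y (EuclideanSpace.single 0 1) - s * c.η₂ y (EuclideanSpace.single 0 1)) / c.det y) •
      EuclideanSpace.single 1 1

theorem plane_eq (v : Plane) :
    v = v 0 • EuclideanSpace.single 0 1 + v 1 • EuclideanSpace.single 1 1 := by
  ext i
  fin_cases i <;> simp

theorem η₁_vec (s t : ℝ) {y : Plane} (h : c.det y ≠ 0) : c.η₁ y (c.vec s t y) = s := by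
  simp only [vec, map_add, map_smul, smul_eq_mul]
  field_simp
  rw [det]
  ring

theorem η₂_vec (s t : ℝ) {y : Plane} (h : c.det y ≠ 0) : c.η₂ y (c.vec s t y) = t := by
  simp only [vec, map_add, map_smul, smul_eq_mul]
  field_simp
  rw [det]
  ring

theorem eq_zero_of_coframe {y : Plane} (h : c.det y ≠ 0) {v : Plane} (h₁ : c.η₁ y v = 0)
    (h₂ : c.η₂ y v = 0) : v = 0 := by
  have e := plane_eq v
  rw [e, map_add, map_smul, map_smul, smul_eq_mul, smul_eq_mul] at h₁ h₂
  have h0 : v 0 = 0 := (mul_eq_zero.1 (by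
    rw [det]
    linear_combination c.η₂ y (EuclideanSpace.single 1 1) * h₁
      - c.η₁ y (EuclideanSpace.single 1 1) * h₂ : v 0 * c.det y = 0)).resolve_right h
  have h1 : v 1 = 0 := (mul_eq_zero.1 (by
    rw [det]
    linear_combination c.η₁ y (EuclideanSpace.single 0 1) * h₂
      - c.η₂ y (EuclideanSpace.single 0 1) * h₁ : v 1 * c.det y = 0)).resolve_right h
  rw [e, h0, h1]
  simp

theorem eq_vec {y : Plane} (h : c.det y ≠ 0) (v : Plane) :
    v = c.η₁ y v • c.vec 1 0 y + c.η₂ y v • c.vec 0 1 y := by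
  rw [← sub_eq_zero]
  refine c.eq_zero_of_coframe h ?_ ?_ <;> simp [c.η₁_vec _ _ h, c.η₂_vec _ _ h]

theorem smooth_vec (hdet : ∀ y ∈ U, c.det y ≠ 0) (s t : ℝ) : ContDiffOn ℝ ∞ (c.vec s t) U := by
  have h1 := fun v : Plane => c.smooth_η₁.clm_apply (contDiffOn_const (c := v))
  have h2 := fun v : Plane => c.smooth_η₂.clm_apply (contDiffOn_const (c := v))
  have hd : ContDiffOn ℝ ∞ c.det U := ((h1 _).mul (h2 _)).sub ((h1 _).mul (h2 _))
  exact ((((contDiffOn_const.mul (h2 _)).sub (contDiffOn_const.mul (h1 _))).div hd hdet).smul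
    contDiffOn_const).add ((((contDiffOn_const.mul (h1 _)).sub (contDiffOn_const.mul (h2 _))).div
    hd hdet).smul contDiffOn_const)

/-- The Killing equation in terms of the Lie derivatives of the coframing. -/
theorem killing_pointwise {η₁ η₂ A₁ A₂ : Plane →L[ℝ] ℝ} {e₁ e₂ : Plane}
    (h₁₁ : η₁ e₁ = 1) (h₁₂ : η₁ e₂ = 0) (h₂₁ : η₂ e₁ = 0) (h₂₂ : η₂ e₂ = 1)
    (he : ∀ v, v = η₁ v • e₁ + η₂ v • e₂)
    (h : ∀ a b, A₁ a * η₁ b + η₁ a * A₁ b - (A₂ a * η₂ b + η₂ a * A₂ b) = 0) (v : Plane) :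
    A₁ v = A₁ e₂ * η₂ v ∧ A₂ v = A₁ e₂ * η₁ v := by
  have h1 := h e₁ e₁
  have h2 := h e₂ e₂
  have h3 := h e₁ e₂
  rw [h₁₁, h₂₁] at h1
  rw [h₁₂, h₂₂] at h2
  rw [h₁₁, h₁₂, h₂₁, h₂₂] at h3
  have e1 : A₁ v = η₁ v * A₁ e₁ + η₂ v * A₁ e₂ := by
    conv_lhs => rw [he v]
    simp
  have e2 : A₂ v = η₁ v * A₂ e₁ + η₂ v * A₂ e₂ := by
    conv_lhs => rw [he v]
    simp
  constructor
  · rw [e1]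
    linear_combination η₁ v / 2 * h1
  · rw [e2]
    linear_combination - η₁ v * h3 - η₂ v / 2 * h2

/-- The Killing equation says that the flow of `X` acts on the coframe by an infinitesimal boost, so
one function `f` controls the derivatives of the components of `X`. Their second derivatives
determine `df`. -/
theorem exists_killingFrame (hU : IsOpen U) (hdet : ∀ y ∈ U, c.det y ≠ 0) {X : Plane → Plane}
    (hX : ContDiffOn ℝ ∞ X U)
    (hK : ∀ y ∈ U, ∀ a b, fderiv ℝ (fun z => c.η₁ z a * c.η₁ z b - c.η₂ z a * c.η₂ z b) y (X y)
      + (c.η₁ y (fderiv ℝ X y a) * c.η₁ y b - c.η₂ y (fderiv ℝ X y a) * c.η₂ y b)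
      + (c.η₁ y a * c.η₁ y (fderiv ℝ X y b) - c.η₂ y a * c.η₂ y (fderiv ℝ X y b)) = 0)
    (hs : ∀ y ∈ U, c.η₁ y (X y) ^ 2 < c.η₂ y (X y) ^ 2) : ∃ k : KillingFrame c, k.X = X := by
  have h11 := fun y hy => c.η₁_vec 1 0 (hdet y hy)
  have h12 := fun y hy => c.η₁_vec 0 1 (hdet y hy)
  have h21 := fun y hy => c.η₂_vec 1 0 (hdet y hy)
  have h22 := fun y hy => c.η₂_vec 0 1 (hdet y hy)
  have sv := c.smooth_vec hdet
  have sx₁ := c.smooth_η₁.clm_apply hX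
  have sx₂ := c.smooth_η₂.clm_apply hX
  have dX := fun y hy => (differentiableAt_of_contDiffOn hU hX (y := y) hy).hasFDerivAt
  have d1 := fun y hy => (differentiableAt_of_contDiffOn hU c.smooth_η₁ (y := y) hy).hasFDerivAt
  have d2 := fun y hy => (differentiableAt_of_contDiffOn hU c.smooth_η₂ (y := y) hy).hasFDerivAt
  have d12 := fun y hy => (differentiableAt_of_contDiffOn hU c.smooth_η₁₂ (y := y) hy).hasFDerivAt
  -- The boost rate, namely the Lie derivative of `η₁` along `X` evaluated on the second frame
  -- vector, corrected by `η₁₂(X)` so that the result is the coefficient of `∇X`.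
  set f : Plane → ℝ := fun y => fderiv ℝ c.η₁ y (X y) (c.vec 0 1 y)
    + c.η₁ y (fderiv ℝ X y (c.vec 0 1 y)) + c.η₁₂ y (X y) with hf
  have sf : ContDiffOn ℝ ∞ f U :=
    (((contDiffOn_fderiv_apply hU c.smooth_η₁ hX).clm_apply (sv 0 1)).add
      (c.smooth_η₁.clm_apply (contDiffOn_fderiv_apply hU hX (sv 0 1)))).add
      (c.smooth_η₁₂.clm_apply hX)
  have key : ∀ y ∈ U, ∀ v,
      fderiv ℝ c.η₁ y (X y) v + c.η₁ y (fderiv ℝ X y v) = (f y - c.η₁₂ y (X y)) * c.η₂ y v ∧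
      fderiv ℝ c.η₂ y (X y) v + c.η₂ y (fderiv ℝ X y v) = (f y - c.η₁₂ y (X y)) * c.η₁ y v := by
    intro y hy v
    have := killing_pointwise (A₁ := fderiv ℝ c.η₁ y (X y) + c.η₁ y ∘L fderiv ℝ X y)
      (A₂ := fderiv ℝ c.η₂ y (X y) + c.η₂ y ∘L fderiv ℝ X y)
      (h11 y hy) (h12 y hy) (h21 y hy) (h22 y hy) (c.eq_vec (hdet y hy)) (fun a b => by
        have h := hK y hy a b
        have e1 := fun a => (d1 y hy).clm_apply (hasFDerivAt_const a y)
        have e2 := fun a => (d2 y hy).clm_apply (hasFDerivAt_const a y)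
        have e := ((e1 a).mul (e1 b)).sub ((e2 a).mul (e2 b))
        have e' : fderiv ℝ (fun z => c.η₁ z a * c.η₁ z b - c.η₂ z a * c.η₂ z b) y = _ := e.fderiv
        rw [e'] at h
        simp at h ⊢
        linear_combination h) v
    simpa [hf] using this
  have dx₁ : ∀ y ∈ U, ∀ v, fderiv ℝ (fun y => c.η₁ y (X y)) y v
      = f y * c.η₂ y v - c.η₂ y (X y) * c.η₁₂ y v := by
    intro y hy v
    have hd := c.d_η₁ y hy v (X y)
    rw [((d1 y hy).clm_apply (dX y hy)).fderiv]
    simp only [extD, wedge] at hd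
    simp
    linear_combination hd + (key y hy v).1
  have dx₂ : ∀ y ∈ U, ∀ v, fderiv ℝ (fun y => c.η₂ y (X y)) y v
      = f y * c.η₁ y v - c.η₁ y (X y) * c.η₁₂ y v := by
    intro y hy v
    have hd := c.d_η₂ y hy v (X y)
    rw [((d2 y hy).clm_apply (dX y hy)).fderiv]
    simp only [extD, wedge] at hd
    simp
    linear_combination hd + (key y hy v).2
  have df : ∀ y ∈ U, ∀ v, fderiv ℝ f y v
      = -(c.K y * (c.η₂ y (X y) * c.η₁ y v - c.η₁ y (X y) * c.η₂ y v)) := by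
    intro y hy v
    have hfd := (differentiableAt_of_contDiffOn hU sf hy).hasFDerivAt
    have hx1 := (differentiableAt_of_contDiffOn hU sx₁ hy).hasFDerivAt
    have hx2 := (differentiableAt_of_contDiffOn hU sx₂ hy).hasFDerivAt
    have e1 : fderiv ℝ (fun y => c.η₁ y (X y)) =ᶠ[nhds y]
        fun y => f y • c.η₂ y - c.η₂ y (X y) • c.η₁₂ y := by
      filter_upwards [hU.mem_nhds hy] with z hz
      ext v
      simp [dx₁ z hz]
    have e2 : fderiv ℝ (fun y => c.η₂ y (X y)) =ᶠ[nhds y]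
        fun y => f y • c.η₁ y - c.η₁ y (X y) • c.η₁₂ y := by
      filter_upwards [hU.mem_nhds hy] with z hz
      ext v
      simp [dx₂ z hz]
    -- Symmetry of the second derivatives of `x₁` and `x₂` on the frame vectors, combined with the
    -- structure equations, gives the two components of `df`.
    have s1 := fderiv_fderiv_symm hU sx₁ hy (c.vec 1 0 y) (c.vec 0 1 y)
    have s2 := fderiv_fderiv_symm hU sx₂ hy (c.vec 1 0 y) (c.vec 0 1 y)
    have c1 : fderiv ℝ (fun y => f y • c.η₂ y - c.η₂ y (X y) • c.η₁₂ y) y = _ :=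
      ((hfd.smul (d2 y hy)).sub (hx2.smul (d12 y hy))).fderiv
    have c2 : fderiv ℝ (fun y => f y • c.η₁ y - c.η₁ y (X y) • c.η₁₂ y) y = _ :=
      ((hfd.smul (d1 y hy)).sub (hx1.smul (d12 y hy))).fderiv
    rw [e1.fderiv_eq, c1] at s1
    rw [e2.fderiv_eq, c2] at s2
    have g1 := c.d_η₁ y hy (c.vec 1 0 y) (c.vec 0 1 y)
    have g2 := c.d_η₂ y hy (c.vec 1 0 y) (c.vec 0 1 y)
    have g12 := c.d_η₁₂ y hy (c.vec 1 0 y) (c.vec 0 1 y)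
    simp only [extD, wedge, h11 y hy, h12 y hy, h21 y hy, h22 y hy] at g1 g2 g12
    simp only [sub_apply, add_apply, smul_apply, ContinuousLinearMap.smulRight_apply, smul_eq_mul,
      h11 y hy, h12 y hy, h21 y hy, h22 y hy, dx₁ y hy, dx₂ y hy] at s1 s2
    have f1 : fderiv ℝ f y (c.vec 1 0 y) = -(c.K y * c.η₂ y (X y)) := by
      linear_combination s1 - f y * g2 + c.η₂ y (X y) * g12
    have f2 : fderiv ℝ f y (c.vec 0 1 y) = c.K y * c.η₁ y (X y) := by
      linear_combination -s2 + f y * g1 - c.η₁ y (X y) * g12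
    conv_lhs => rw [c.eq_vec (hdet y hy) v]
    rw [map_add, map_smul, map_smul, f1, f2, smul_eq_mul, smul_eq_mul]
    ring
  have sX' : ContDiffOn ℝ ∞ (fun y => c.η₂ y (X y) • c.vec 1 0 y + c.η₁ y (X y) • c.vec 0 1 y) U :=
    (sx₂.smul (sv 1 0)).add (sx₁.smul (sv 0 1))
  have hη₁X' : ∀ y ∈ U, c.η₁ y (c.η₂ y (X y) • c.vec 1 0 y + c.η₁ y (X y) • c.vec 0 1 y)
      = c.η₂ y (X y) := fun y hy => by simp [h11 y hy, h12 y hy]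
  have hη₂X' : ∀ y ∈ U, c.η₂ y (c.η₂ y (X y) • c.vec 1 0 y + c.η₁ y (X y) • c.vec 0 1 y)
      = c.η₁ y (X y) := fun y hy => by simp [h21 y hy, h22 y hy]
  generalize hXdef : (fun y => c.η₂ y (X y) • c.vec 1 0 y + c.η₁ y (X y) • c.vec 0 1 y) = X' at sX'
  replace hη₁X' : ∀ y ∈ U, c.η₁ y (X' y) = c.η₂ y (X y) := fun y hy => by
    rw [← hXdef]; exact hη₁X' y hy
  replace hη₂X' : ∀ y ∈ U, c.η₂ y (X' y) = c.η₁ y (X y) := fun y hy => by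
    rw [← hXdef]; exact hη₂X' y hy
  refine ⟨⟨X, X', fun y => c.η₁ y (X y), fun y => c.η₂ y (X y), f, hX, sX', sx₁, sx₂, sf,
    fun _ _ => rfl, fun _ _ => rfl, hη₁X', hη₂X', dx₁, dx₂, df, fun y hy => ?_, hs⟩, rfl⟩
  have dX' := (differentiableAt_of_contDiffOn hU sX' hy).hasFDerivAt
  -- Since `η₁(X') = x₂` and `η₂(X') = x₁`, differentiating along `X` and comparing with the Lie
  -- derivatives of the coframe shows that both coframe forms kill `[X, X']`.
  have p1 : fderiv ℝ (fun y => c.η₁ y (X' y)) y = fderiv ℝ (fun y => c.η₂ y (X y)) y :=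
    Filter.EventuallyEq.fderiv_eq (by filter_upwards [hU.mem_nhds hy] with z hz using hη₁X' z hz)
  have p2 : fderiv ℝ (fun y => c.η₂ y (X' y)) y = fderiv ℝ (fun y => c.η₁ y (X y)) y :=
    Filter.EventuallyEq.fderiv_eq (by filter_upwards [hU.mem_nhds hy] with z hz using hη₂X' z hz)
  rw [((d1 y hy).clm_apply dX').fderiv] at p1
  rw [((d2 y hy).clm_apply dX').fderiv] at p2
  have q1 := congrArg (fun F => F (X y)) p1
  have q2 := congrArg (fun F => F (X y)) p2
  have r1 := (key y hy (X' y)).1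
  have r2 := (key y hy (X' y)).2
  simp only [add_apply, ContinuousLinearMap.comp_apply, ContinuousLinearMap.flip_apply,
    dx₁ y hy, dx₂ y hy] at q1 q2
  rw [hη₁X' y hy] at r2
  rw [hη₂X' y hy] at r1
  rw [← sub_eq_zero]
  refine c.eq_zero_of_coframe (hdet y hy) ?_ ?_
  · rw [map_sub]
    linear_combination q1 - r1
  · rw [map_sub]
    linear_combination q2 - r2

end CartanFrame
-- Integration of the equations for `f`, `N`, `K`
namespace KillingFrame

variable {U : Set Plane} {c : CartanFrame U} (k : KillingFrame c)

/-- The form `⋆X♭`, with `dN = 2 f ⋆X♭` and `df = -K ⋆X♭`. -/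
noncomputable def dualForm (y : Plane) : Plane →L[ℝ] ℝ := k.x₂ y • c.η₁ y - k.x₁ y • c.η₂ y

/-- The form `X♭ / N`, which is closed. -/
noncomputable def angleForm (y : Plane) : Plane →L[ℝ] ℝ :=
  (k.N y)⁻¹ • (k.x₁ y • c.η₁ y - k.x₂ y • c.η₂ y)

theorem hasFDerivAt_N (hU : IsOpen U) {y : Plane} (hy : y ∈ U) :
    HasFDerivAt k.N ((2 * k.f y) • k.dualForm y) y := by
  refine (differentiableAt_of_contDiffOn hU k.smooth_N hy).hasFDerivAt.congr_fderiv
    (ContinuousLinearMap.ext fun v => ?_)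
  simp [k.fderiv_N hU hy, dualForm]

theorem hasFDerivAt_f (hU : IsOpen U) {y : Plane} (hy : y ∈ U) :
    HasFDerivAt k.f (-c.K y • k.dualForm y) y := by
  refine (differentiableAt_of_contDiffOn hU k.smooth_f hy).hasFDerivAt.congr_fderiv
    (ContinuousLinearMap.ext fun v => ?_)
  simp [k.d_f y hy, dualForm]

/-- At a zero of `f` the curvature equation would read `0 = -4K²N`, whereas `K` and `N` are
positive. -/
theorem f_ne_zero (hU : IsOpen U) (hc : c.IsEllipticDarbouxIntegrable) {y : Plane} (hy : y ∈ U) :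
    k.f y ≠ 0 := by
  intro h
  have := k.f_mul_fderiv_K hU hc hy
  rw [h, zero_mul] at this
  have h1 := hc.1 y hy
  have h2 := k.N_pos hy
  have : 0 < c.K y ^ 2 * k.N y := by positivity
  linarith

theorem hasFDerivAt_K (hU : IsOpen U) (hdet : ∀ y ∈ U, c.det y ≠ 0)
    (hc : c.IsEllipticDarbouxIntegrable) {y : Plane} (hy : y ∈ U) :
    HasFDerivAt c.K ((-4 * c.K y ^ 2 / k.f y) • k.dualForm y) y := by
  refine (differentiableAt_of_contDiffOn hU c.smooth_K hy).hasFDerivAt.congr_fderiv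
    (ContinuousLinearMap.ext fun v => ?_)
  -- Expansion of `v` in the basis `X'`, `X`; the coefficient of `X'` is the dual form, and `K` does
  -- not vary along `X`.
  have hv : k.N y • v = (k.x₂ y * c.η₁ y v - k.x₁ y * c.η₂ y v) • k.X' y
      + (k.x₂ y * c.η₂ y v - k.x₁ y * c.η₁ y v) • k.X y := by
    rw [← sub_eq_zero]
    refine c.eq_zero_of_coframe (hdet y hy) ?_ ?_ <;>
      simp [k.η₁_X y hy, k.η₂_X y hy, k.η₁_X' y hy, k.η₂_X' y hy, N] <;> ring
  have h := congrArg (fderiv ℝ c.K y) hv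
  rw [map_smul, map_add, map_smul, map_smul, k.fderiv_K_X hU hy, smul_eq_mul, smul_eq_mul,
    smul_zero, add_zero] at h
  have h0 := k.f_mul_fderiv_K hU hc hy
  have hf := k.f_ne_zero hU hc hy
  have hN := (k.N_pos hy).ne'
  simp only [dualForm, smul_apply, sub_apply, smul_eq_mul]
  refine mul_left_cancel₀ (mul_ne_zero hf hN) ?_
  rw [mul_assoc, h]
  field_simp
  linear_combination (k.x₂ y * c.η₁ y v - k.x₁ y * c.η₂ y v) * h0

theorem smooth_angleForm : ContDiffOn ℝ ∞ k.angleForm U :=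
  (k.smooth_N.inv fun _ hy => (k.N_pos hy).ne').smul
    ((k.smooth_x₁.smul c.smooth_η₁).sub (k.smooth_x₂.smul c.smooth_η₂))

/-- The form takes the constant values `-1` and `0` on the commuting fields `X` and `X'`, whence
closedness; the proof checks it through the structure equations. -/
theorem angleForm_closed (hU : IsOpen U) {y : Plane} (hy : y ∈ U) (v w : Plane) :
    fderiv ℝ k.angleForm y v w = fderiv ℝ k.angleForm y w v := by
  have hN := (k.N_pos hy).ne'
  have hi : HasFDerivAt (fun z => (k.N z)⁻¹) (-(k.N y ^ 2)⁻¹ • ((2 * k.f y) • k.dualForm y)) y :=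
    (hasDerivAt_inv hN).comp_hasFDerivAt y (k.hasFDerivAt_N hU hy)
  have d1 := (differentiableAt_of_contDiffOn hU c.smooth_η₁ hy).hasFDerivAt
  have d2 := (differentiableAt_of_contDiffOn hU c.smooth_η₂ hy).hasFDerivAt
  have e1 := (differentiableAt_of_contDiffOn hU k.smooth_x₁ hy).hasFDerivAt
  have e2 := (differentiableAt_of_contDiffOn hU k.smooth_x₂ hy).hasFDerivAt
  have h : HasFDerivAt k.angleForm _ y := hi.smul ((e1.smul d1).sub (e2.smul d2))
  have g1 := c.d_η₁ y hy v w
  have g2 := c.d_η₂ y hy v w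
  simp only [extD, wedge] at g1 g2
  rw [h.fderiv]
  simp only [dualForm, sub_apply, add_apply, smul_apply, ContinuousLinearMap.smulRight_apply,
    smul_eq_mul, k.d_x₁ y hy, k.d_x₂ y hy]
  have hN' : k.N y = k.x₂ y ^ 2 - k.x₁ y ^ 2 := rfl
  field_simp
  linear_combination k.N y * k.x₁ y * g1 - k.N y * k.x₂ y * g2
    + 2 * k.f y * (c.η₁ y w * c.η₂ y v - c.η₁ y v * c.η₂ y w) * hN'

theorem metric_eq {y : Plane} (hy : y ∈ U) (a b : Plane) :
    c.η₁ y a * c.η₁ y b - c.η₂ y a * c.η₂ y b = (k.N y)⁻¹ * (k.dualForm y a * k.dualForm y b)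
      - k.N y * (k.angleForm y a * k.angleForm y b) := by
  have hN := (k.N_pos hy).ne'
  simp only [dualForm, angleForm, sub_apply, smul_apply, smul_eq_mul]
  field_simp
  rw [N]
  ring

/-- The three families of metrics `A(u) du² - B(u) dv²`. -/
def IsModel (A B : ℝ → ℝ) : Prop :=
  (∃ r : ℝ, 0 < r ∧ A = (fun u => r * Real.cosh u ^ 4) ∧ B = fun u => r * Real.sinh u ^ 2) ∨
  (∃ r : ℝ, 0 < r ∧ A = (fun u => r * Real.sinh u ^ 4) ∧ B = fun u => r * Real.cosh u ^ 2) ∨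
  (A = (fun u => u ^ 2) ∧ B = fun u => u ^ 2)

/-- The first integrals of the system satisfied by `f`, `N`, `K`. -/
theorem exists_first_integrals (hU : IsOpen U) (hdet : ∀ y ∈ U, c.det y ≠ 0)
    (hc : c.IsEllipticDarbouxIntegrable) {W : Set Plane} (hW : IsOpen W) (hWc : IsPreconnected W)
    (hWU : W ⊆ U) (hne : W.Nonempty) :
    ∃ r b : ℝ, 0 < r ∧ ∀ y ∈ W, k.N y * (r * k.f y ^ 2) = 1 + b * (r * k.f y ^ 2) := by
  have ht : ∀ y ∈ U, HasFDerivAt (fun z => (k.f z)⁻¹)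
      (-(k.f y ^ 2)⁻¹ • (-c.K y • k.dualForm y)) y := fun y hy =>
    (hasDerivAt_inv (k.f_ne_zero hU hc hy)).comp_hasFDerivAt y (k.hasFDerivAt_f hU hy)
  -- From `df = -K ⋆X♭` and `dK = -(4K²/f) ⋆X♭` one gets `dK/K = 4 df/f`, so `K f⁻⁴` is a constant
  -- `r`.
  have h1 : ∀ y ∈ W, HasFDerivAt (fun z => c.K z * (k.f z)⁻¹ ^ 4) (0 : Plane →L[ℝ] ℝ) y := by
    intro y hy
    have hf := k.f_ne_zero hU hc (hWU hy)
    refine ((k.hasFDerivAt_K hU hdet hc (hWU hy)).mul ((ht y (hWU hy)).pow 4)).congr_fderiv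
      (ContinuousLinearMap.ext fun v => ?_)
    simp
    field_simp
    ring
  obtain ⟨r, hr⟩ := hW.exists_is_const_of_fderiv_eq_zero (𝕜 := ℝ) hWc
    (fun y hy => (h1 y hy).differentiableAt.differentiableWithinAt) fun y hy => (h1 y hy).fderiv
  have hrK : ∀ y ∈ W, c.K y = r * k.f y ^ 4 := fun y hy => by
    have hf := k.f_ne_zero hU hc (hWU hy)
    rw [← hr y hy]
    field_simp
  have hr0 : 0 < r := by
    obtain ⟨y, hy⟩ := hne
    have h := hc.1 y (hWU hy)
    rw [hrK y hy] at h
    exact pos_of_mul_pos_left h (by positivity)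
  -- With `K = r f⁴`, the differential of `1/(r f²)` is `2f ⋆X♭ = dN`.
  have h2 : ∀ y ∈ W, HasFDerivAt (fun z => k.N z - r⁻¹ * (k.f z)⁻¹ ^ 2) (0 : Plane →L[ℝ] ℝ) y := by
    intro y hy
    have hf := k.f_ne_zero hU hc (hWU hy)
    refine ((k.hasFDerivAt_N hU (hWU hy)).sub (((ht y (hWU hy)).pow 2).const_mul r⁻¹)).congr_fderiv
      (ContinuousLinearMap.ext fun v => ?_)
    simp [hrK y hy]
    field_simp
    ring
  obtain ⟨b, hb⟩ := hW.exists_is_const_of_fderiv_eq_zero (𝕜 := ℝ) hWc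
    (fun y hy => (h2 y hy).differentiableAt.differentiableWithinAt) fun y hy => (h2 y hy).fderiv
  refine ⟨r, b, hr0, fun y hy => ?_⟩
  have hf := k.f_ne_zero hU hc (hWU hy)
  rw [← hb y hy]
  field_simp
  ring

/-- The coordinate `u` as a function of `N`. -/
theorem exists_coordinate_u (hU : IsOpen U) {W : Set Plane} (hWU : W ⊆ U) {r b : ℝ} (hr : 0 < r)
    (hb : ∀ y ∈ W, k.N y * (r * k.f y ^ 2) = 1 + b * (r * k.f y ^ 2))
    (hf : ∀ y ∈ W, k.f y ≠ 0) :
    ∃ (u : Plane → ℝ) (κ : ℝ) (A B : ℝ → ℝ) (q : Plane → ℝ), IsModel A B ∧ ContDiffOn ℝ ∞ u W ∧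
      (∀ y ∈ W, 0 < u y) ∧ ∀ y ∈ W, HasFDerivAt u (q y • k.dualForm y) y ∧
        A (u y) * q y ^ 2 = (k.N y)⁻¹ ∧ B (u y) * κ ^ 2 = k.N y := by
  have sN := k.smooth_N.mono hWU
  have dN := fun y (hy : y ∈ W) => k.hasFDerivAt_N hU (hWU hy)
  have pN := fun y (hy : y ∈ W) => k.N_pos (hWU hy)
  have hr' := hr.ne'
  rcases lt_trichotomy b 0 with hb0 | hb0 | hb0
  · obtain ⟨d, hd, rfl⟩ : ∃ d : ℝ, 0 < d ∧ b = -d := ⟨-b, by linarith, by ring⟩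
    have hd' := hd.ne'
    have ps : ∀ y ∈ W, 0 < k.N y / d := fun y hy => div_pos (pN y hy) hd
    have dq : ∀ y ∈ W, HasFDerivAt (fun z => k.N z / d) (d⁻¹ • ((2 * k.f y) • k.dualForm y)) y :=
      fun y hy => by
        simpa only [div_eq_mul_inv, mul_comm] using (dN y hy).const_mul d⁻¹
    -- Here `u` solves `N = d sinh² u`, and the first integral becomes `cosh² u = 1/(r d f²)`. This
    -- fixes the scale `r d²` of the metric and the factor `κ = (r d)^{-1/2}` of `v`.
    refine ⟨fun y => Real.arsinh (Real.sqrt (k.N y / d)), (Real.sqrt (r * d))⁻¹,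
      fun u => r * d ^ 2 * Real.cosh u ^ 4, fun u => r * d ^ 2 * Real.sinh u ^ 2,
      fun y => (Real.sqrt (1 + Real.sqrt (k.N y / d) ^ 2))⁻¹ *
        (1 / (2 * Real.sqrt (k.N y / d)) * (d⁻¹ * (2 * k.f y))),
      Or.inl ⟨r * d ^ 2, by positivity, rfl, rfl⟩,
      ((sN.div_const d).sqrt fun y hy => (ps y hy).ne').arsinh,
      fun y hy => Real.arsinh_pos_iff.2 (Real.sqrt_pos.2 (ps y hy)), fun y hy => ⟨?_, ?_, ?_⟩⟩
    · exact (((dq y hy).sqrt (ps y hy).ne').arsinh).congr_fderiv (by simp only [smul_smul])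
    · have h1 := Real.sq_sqrt (ps y hy).le
      have h2 := Real.sq_sqrt (by positivity : (0 : ℝ) ≤ 1 + Real.sqrt (k.N y / d) ^ 2)
      have h3 := hb y hy
      have hN := pN y hy
      have h4 : Real.cosh (Real.arsinh (Real.sqrt (k.N y / d))) ^ 4 = (1 + k.N y / d) ^ 2 := by
        rw [Real.cosh_arsinh, show (4 : ℕ) = 2 * 2 from rfl, pow_mul, h2, h1]
      simp only [h4, mul_pow, inv_pow, div_pow, h2]
      rw [h1]
      have : 1 + k.N y / d ≠ 0 := by positivity
      have h5 : (1 + k.N y / d) * (r * d * k.f y ^ 2) = 1 := by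
        field_simp
        linear_combination h3
      field_simp
      field_simp at h5
      linear_combination h5
    · have h1 := Real.sq_sqrt (ps y hy).le
      have h2 := Real.sq_sqrt (by positivity : (0 : ℝ) ≤ r * d)
      simp only [Real.sinh_arsinh, inv_pow, h1, h2]
      field_simp
  · subst hb0
    have pr := Real.sqrt_pos.2 hr
    have prr := Real.sqrt_pos.2 pr
    -- Here `u² = √r N`. A homothety of `(u, v)` rescales this model, so `r` is absorbed in the
    -- coordinates and no constant remains.
    refine ⟨fun y => Real.sqrt (Real.sqrt r) * Real.sqrt (k.N y), (Real.sqrt (Real.sqrt r))⁻¹,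
      fun u => u ^ 2, fun u => u ^ 2,
      fun y => Real.sqrt (Real.sqrt r) * (1 / (2 * Real.sqrt (k.N y)) * (2 * k.f y)),
      Or.inr (Or.inr ⟨rfl, rfl⟩), contDiffOn_const.mul (sN.sqrt fun y hy => (pN y hy).ne'),
      fun y hy => mul_pos prr (Real.sqrt_pos.2 (pN y hy)), fun y hy => ⟨?_, ?_, ?_⟩⟩
    · exact (((dN y hy).sqrt (pN y hy).ne').const_mul (Real.sqrt (Real.sqrt r))).congr_fderiv
        (by simp only [smul_smul])
    · have h0 := Real.sq_sqrt (pN y hy).le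
      have h1 := Real.sq_sqrt pr.le
      have h2 := Real.sq_sqrt hr.le
      have h3 := hb y hy
      have hN := pN y hy
      have hs := Real.sqrt_pos.2 hN
      simp only [mul_pow, div_pow, h0, h1]
      field_simp
      rw [h2]
      linear_combination h3
    · have h0 := Real.sq_sqrt (pN y hy).le
      simp only [mul_pow, inv_pow, h0]
      field_simp
  · have hb' := hb0.ne'
    -- The first integral gives `N > b`, so `N = b cosh² u` can be solved with `u > 0`, and then
    -- `sinh² u = 1/(r b f²)`.
    have e : ∀ y ∈ W, k.N y / b - 1 = (r * b * k.f y ^ 2)⁻¹ := fun y hy => by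
      have := hb y hy
      have := hf y hy
      field_simp
      linear_combination hb y hy
    have ps : ∀ y ∈ W, 0 < k.N y / b - 1 := fun y hy => by
      have := hf y hy
      rw [e y hy]
      positivity
    have dq : ∀ y ∈ W, HasFDerivAt (fun z => k.N z / b - 1)
        (b⁻¹ • ((2 * k.f y) • k.dualForm y)) y := fun y hy => by
      simpa only [div_eq_mul_inv, mul_comm] using ((dN y hy).const_mul b⁻¹).sub_const 1
    refine ⟨fun y => Real.arsinh (Real.sqrt (k.N y / b - 1)), (Real.sqrt (r * b))⁻¹,
      fun u => r * b ^ 2 * Real.sinh u ^ 4, fun u => r * b ^ 2 * Real.cosh u ^ 2,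
      fun y => (Real.sqrt (1 + Real.sqrt (k.N y / b - 1) ^ 2))⁻¹ *
        (1 / (2 * Real.sqrt (k.N y / b - 1)) * (b⁻¹ * (2 * k.f y))),
      Or.inr (Or.inl ⟨r * b ^ 2, by positivity, rfl, rfl⟩),
      (((sN.div_const b).sub contDiffOn_const).sqrt fun y hy => (ps y hy).ne').arsinh,
      fun y hy => Real.arsinh_pos_iff.2 (Real.sqrt_pos.2 (ps y hy)), fun y hy => ⟨?_, ?_, ?_⟩⟩
    · exact (((dq y hy).sqrt (ps y hy).ne').arsinh).congr_fderiv (by simp only [smul_smul])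
    · have h1 := Real.sq_sqrt (ps y hy).le
      have h2 := Real.sq_sqrt (by positivity : (0 : ℝ) ≤ 1 + Real.sqrt (k.N y / b - 1) ^ 2)
      rw [h1, add_sub_cancel] at h2
      have hN := pN y hy
      have hf' := hf y hy
      have hp := ps y hy
      have h4 : Real.sqrt (k.N y / b - 1) ^ 4 = (k.N y / b - 1) ^ 2 := by
        rw [show (4 : ℕ) = 2 * 2 from rfl, pow_mul, h1]
      simp only [Real.sinh_arsinh, h4, mul_pow, inv_pow, div_pow, h1, add_sub_cancel, h2]
      rw [e y hy]
      field_simp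
    · have h1 := Real.sq_sqrt (ps y hy).le
      have h2 := Real.sq_sqrt (by positivity : (0 : ℝ) ≤ 1 + Real.sqrt (k.N y / b - 1) ^ 2)
      rw [h1, add_sub_cancel] at h2
      have h3 := Real.sq_sqrt (by positivity : (0 : ℝ) ≤ r * b)
      simp only [Real.cosh_arsinh, inv_pow, h1, add_sub_cancel, h2, h3]
      field_simp

/-- Functions `u`, `v` near a point, in which the metric is one of the models. -/
theorem exists_coordinates (k : KillingFrame c) (hU : IsOpen U) (hdet : ∀ y ∈ U, c.det y ≠ 0)
    (hc : c.IsEllipticDarbouxIntegrable) {p : Plane} (hp : p ∈ U) :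
    ∃ W ⊆ U, IsOpen W ∧ p ∈ W ∧ ∃ (u v : Plane → ℝ) (A B : ℝ → ℝ), IsModel A B ∧
      ContDiffOn ℝ ∞ u W ∧ ContDiffOn ℝ ∞ v W ∧ (∀ y ∈ W, 0 < u y) ∧
      ∀ y ∈ W, ∀ a b, c.η₁ y a * c.η₁ y b - c.η₂ y a * c.η₂ y b =
        A (u y) * (fderiv ℝ u y a * fderiv ℝ u y b)
          - B (u y) * (fderiv ℝ v y a * fderiv ℝ v y b) := by
  obtain ⟨ε, hε, hεU⟩ := Metric.isOpen_iff.1 hU p hp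
  obtain ⟨r, b, hr, hb⟩ := k.exists_first_integrals hU hdet hc Metric.isOpen_ball
    (convex_ball p ε).isPreconnected hεU ⟨p, Metric.mem_ball_self hε⟩
  obtain ⟨u, κ, A, B, q, hAB, su, pu, hu⟩ := k.exists_coordinate_u hU hεU hr hb
    fun y hy => k.f_ne_zero hU hc (hεU hy)
  have sβ := k.smooth_angleForm.mono hεU
  -- Poincaré lemma for the closed form `X♭/N` on a ball.
  obtain ⟨V, hV⟩ := (convex_ball p ε).exists_forall_hasFDerivAt_of_fderiv_symmetric
    Metric.isOpen_ball (sβ.differentiableOn (by simp))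
    fun y hy => k.angleForm_closed hU (hεU hy)
  have sV : ContDiffOn ℝ ∞ V (Metric.ball p ε) := by
    rw [contDiffOn_infty_iff_fderiv_of_isOpen Metric.isOpen_ball]
    exact ⟨fun y hy => (hV y hy).differentiableAt.differentiableWithinAt,
      sβ.congr fun y hy => (hV y hy).fderiv⟩
  refine ⟨_, hεU, Metric.isOpen_ball, Metric.mem_ball_self hε, u, fun y => κ * V y, A, B, hAB, su,
    contDiffOn_const.mul sV, pu, fun y hy a b => ?_⟩
  obtain ⟨h1, h2, h3⟩ := hu y hy
  rw [h1.fderiv, ((hV y hy).const_mul κ).fderiv, k.metric_eq (hεU hy), ← h2]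
  simp only [smul_apply, smul_eq_mul]
  linear_combination (k.angleForm y a * k.angleForm y b) * h3

end KillingFrame

/-! ### Gauss curvature of the models -/

/-- The coordinate covectors of the plane. -/
noncomputable def coordCovector (i : Fin 2) : Plane →L[ℝ] ℝ := EuclideanSpace.proj i

@[simp] theorem coordCovector_apply (i : Fin 2) (v : Plane) : coordCovector i v = v i := rfl

theorem extD_smul_coordCovector {h : ℝ → ℝ} {h' : ℝ} {y : Plane} (hh : HasDerivAt h h' (y 0))
    (i : Fin 2) (v w : Plane) :
    extD (fun z : Plane => h (z 0) • coordCovector i) y v w = h' * (v 0 * w i - w 0 * v i) := by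
  have h0 : HasFDerivAt (fun z : Plane => z 0) (coordCovector 0) y :=
    (coordCovector 0).hasFDerivAt
  have h1 : HasFDerivAt (fun z : Plane => h (z 0)) (h' • coordCovector 0) y :=
    hh.comp_hasFDerivAt y h0
  rw [extD, (h1.smul_const (coordCovector i)).fderiv]
  simp only [ContinuousLinearMap.smulRight_apply, smul_apply, smul_eq_mul, coordCovector_apply]
  ring

theorem contDiffOn_comp_coord {h : ℝ → ℝ} (hh : ContDiffOn ℝ ∞ h (Set.Ioi 0)) {U : Set Plane}
    (hU : ∀ y ∈ U, 0 < y 0) : ContDiffOn ℝ ∞ (fun y : Plane => h (y 0)) U :=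
  hh.comp (coordCovector 0).contDiff.contDiffOn hU

/-- The frame `a(u) du`, `b(u) dv`. -/
noncomputable def CartanFrame.diagonal {a b w κ : ℝ → ℝ} (sa : ContDiffOn ℝ ∞ a (Set.Ioi 0))
    (sb : ContDiffOn ℝ ∞ b (Set.Ioi 0)) (sw : ContDiffOn ℝ ∞ w (Set.Ioi 0))
    (sκ : ContDiffOn ℝ ∞ κ (Set.Ioi 0)) (db : ∀ t > 0, HasDerivAt b (w t * a t) t)
    (dw : ∀ t > 0, HasDerivAt w (-(κ t * (a t * b t))) t) {U : Set Plane}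
    (hU : ∀ y ∈ U, 0 < y 0) : CartanFrame U where
  η₁ y := a (y 0) • coordCovector 0
  η₂ y := b (y 0) • coordCovector 1
  η₁₂ y := w (y 0) • coordCovector 1
  K y := κ (y 0)
  smooth_η₁ := (contDiffOn_comp_coord sa hU).smul contDiffOn_const
  smooth_η₂ := (contDiffOn_comp_coord sb hU).smul contDiffOn_const
  smooth_η₁₂ := (contDiffOn_comp_coord sw hU).smul contDiffOn_const
  smooth_K := contDiffOn_comp_coord sκ hU
  d_η₁ y hy v w := by
    have ha := ((sa.contDiffAt (Ioi_mem_nhds (hU y hy))).differentiableAt (by simp)).hasDerivAt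
    rw [extD_smul_coordCovector ha]
    simp only [wedge, smul_apply, smul_eq_mul, coordCovector_apply]
    ring
  d_η₂ y hy v w := by
    rw [extD_smul_coordCovector (db _ (hU y hy))]
    simp only [wedge, smul_apply, smul_eq_mul, coordCovector_apply]
    ring
  d_η₁₂ y hy v w := by
    rw [extD_smul_coordCovector (dw _ (hU y hy))]
    simp only [wedge, smul_apply, smul_eq_mul, coordCovector_apply]
    ring

namespace LorentzMetric

variable {M : Type*} [TopologicalSpace M] [ChartedSpace Plane M] [IsManifold (𝓡 2) ∞ M]

/-- For the coframe `a du`, `b dv` the structure equations give the connection form `w dv` with `w =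
b'/a` and the curvature `κ = -w'/(ab)`. In the three models `w` is `1/cosh u`, `1/sinh u` and `1/u`.
-/
theorem HasDiagonalForm.hasGaussCurvature {g : LorentzMetric M} {φ : OpenPartialHomeomorph M Plane}
    {A B : ℝ → ℝ} (h : g.HasDiagonalForm φ A B) (hφ : ∀ y ∈ φ.target, 0 < y 0) {a b w κ : ℝ → ℝ}
    (sa : ContDiffOn ℝ ∞ a (Set.Ioi 0)) (sb : ContDiffOn ℝ ∞ b (Set.Ioi 0))
    (sw : ContDiffOn ℝ ∞ w (Set.Ioi 0)) (sκ : ContDiffOn ℝ ∞ κ (Set.Ioi 0))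
    (db : ∀ t > 0, HasDerivAt b (w t * a t) t)
    (dw : ∀ t > 0, HasDerivAt w (-(κ t * (a t * b t))) t)
    (hA : ∀ t, A t = a t ^ 2) (hB : ∀ t, B t = b t ^ 2) :
    g.HasGaussCurvature φ fun y => κ (y 0) := by
  refine ⟨.diagonal sa sb sw sκ db dw hφ, fun y hy v w => ?_, fun _ _ => rfl⟩
  rw [h y hy, hA, hB]
  simp only [CartanFrame.diagonal, smul_apply, smul_eq_mul, coordCovector_apply]
  ring

open Real in
theorem HasDiagonalForm.hasGaussCurvature_cosh {g : LorentzMetric M}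
    {φ : OpenPartialHomeomorph M Plane} {r : ℝ} (hr : 0 < r)
    (h : g.HasDiagonalForm φ (fun u => r * cosh u ^ 4) (fun u => r * sinh u ^ 2))
    (hφ : ∀ y ∈ φ.target, 0 < y 0) :
    g.HasGaussCurvature φ fun y => 1 / (r * cosh (y 0) ^ 4) := by
  have hs := sq_sqrt hr.le
  have hc := fun t => (cosh_pos t).ne'
  refine h.hasGaussCurvature hφ (a := fun t => √r * cosh t ^ 2) (b := fun t => √r * sinh t)
    (w := fun t => (cosh t)⁻¹) (κ := fun t => 1 / (r * cosh t ^ 4))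
    (contDiff_const.mul (contDiff_cosh.pow 2)).contDiffOn
    (contDiff_const.mul contDiff_sinh).contDiffOn (contDiff_cosh.inv hc).contDiffOn
    (contDiff_const.div (contDiff_const.mul (contDiff_cosh.pow 4)) fun t =>
      mul_ne_zero hr.ne' (pow_ne_zero 4 (hc t))).contDiffOn
    (fun t _ => ((hasDerivAt_sinh t).const_mul _).congr_deriv ?_)
    (fun t _ => ((hasDerivAt_cosh t).inv (hc t)).congr_deriv ?_)
    (fun t => ?_) (fun t => ?_)
  · have := hc t
    field_simp
  · have := hc t
    field_simp
    rw [hs]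
  · rw [mul_pow, hs]; ring
  · rw [mul_pow, hs]

open Real in
theorem HasDiagonalForm.hasGaussCurvature_sinh {g : LorentzMetric M}
    {φ : OpenPartialHomeomorph M Plane} {r : ℝ} (hr : 0 < r)
    (h : g.HasDiagonalForm φ (fun u => r * sinh u ^ 4) (fun u => r * cosh u ^ 2))
    (hφ : ∀ y ∈ φ.target, 0 < y 0) :
    g.HasGaussCurvature φ fun y => 1 / (r * sinh (y 0) ^ 4) := by
  have hs := sq_sqrt hr.le
  have hc : ∀ t : ℝ, 0 < t → sinh t ≠ 0 := fun t ht => (sinh_pos_iff.2 ht).ne'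
  refine h.hasGaussCurvature hφ (a := fun t => √r * sinh t ^ 2) (b := fun t => √r * cosh t)
    (w := fun t => (sinh t)⁻¹) (κ := fun t => 1 / (r * sinh t ^ 4))
    (contDiff_const.mul (contDiff_sinh.pow 2)).contDiffOn
    (contDiff_const.mul contDiff_cosh).contDiffOn (contDiff_sinh.contDiffOn.inv hc)
    (contDiffOn_const.div (contDiff_const.mul (contDiff_sinh.pow 4)).contDiffOn fun t ht =>
      mul_ne_zero hr.ne' (pow_ne_zero 4 (hc t ht)))
    (fun t ht => ((hasDerivAt_cosh t).const_mul _).congr_deriv ?_)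
    (fun t ht => ((hasDerivAt_sinh t).inv (hc t ht)).congr_deriv ?_)
    (fun t => ?_) (fun t => ?_)
  · have := hc t ht
    field_simp
  · have := hc t ht
    field_simp
    rw [hs]
  · rw [mul_pow, hs]; ring
  · rw [mul_pow, hs]

theorem HasDiagonalForm.hasGaussCurvature_sq {g : LorentzMetric M}
    {φ : OpenPartialHomeomorph M Plane}
    (h : g.HasDiagonalForm φ (fun u => u ^ 2) (fun u => u ^ 2))
    (hφ : ∀ y ∈ φ.target, 0 < y 0) :
    g.HasGaussCurvature φ fun y => 1 / y 0 ^ 4 := by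
  have hc : ∀ t : ℝ, 0 < t → t ≠ 0 := fun t ht => ht.ne'
  refine h.hasGaussCurvature hφ (a := fun t => t) (b := fun t => t)
    (w := fun t => t⁻¹) (κ := fun t => 1 / t ^ 4) contDiffOn_id contDiffOn_id
    (contDiffOn_id.inv hc)
    (contDiffOn_const.div (contDiffOn_id.pow 4) fun t ht => pow_ne_zero 4 (hc t ht))
    (fun t ht => (hasDerivAt_id t).congr_deriv ?_)
    (fun t ht => (hasDerivAt_inv (hc t ht)).congr_deriv ?_)
    (fun _ => rfl) (fun _ => rfl)
  · have := hc t ht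
    field_simp
  · have := hc t ht
    field_simp

end LorentzMetric
-- Passage between the manifold and coordinates
namespace LorentzMetric

variable {M : Type*} [TopologicalSpace M] [ChartedSpace Plane M]

theorem mDifferentiable_of_mem_maximalAtlas {φ : OpenPartialHomeomorph M Plane}
    (hφ : φ ∈ IsManifold.maximalAtlas (𝓡 2) ∞ M) : φ.MDifferentiable (𝓡 2) (𝓡 2) :=
  ⟨(contMDiffOn_of_mem_maximalAtlas hφ).mdifferentiableOn (by simp),
    (contMDiffOn_symm_of_mem_maximalAtlas hφ).mdifferentiableOn (by simp)⟩

theorem mfderiv_symm_mfderiv {φ : OpenPartialHomeomorph M Plane}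
    (hφ : φ ∈ IsManifold.maximalAtlas (𝓡 2) ∞ M) {x : M} {y : Plane} (hx : x ∈ φ.source)
    (hxy : φ x = y) (v : TangentSpace (𝓡 2) x) :
    (mfderiv (𝓡 2) (𝓡 2) φ.symm y (mfderiv (𝓡 2) (𝓡 2) φ x v : Plane) : Plane) = v := by
  subst hxy
  exact DFunLike.congr_fun ((mDifferentiable_of_mem_maximalAtlas hφ).symm_comp_deriv hx) v

theorem mfderiv_symm_coordField (X : (x : M) → TangentSpace (𝓡 2) x)
    {φ : OpenPartialHomeomorph M Plane} (hφ : φ ∈ IsManifold.maximalAtlas (𝓡 2) ∞ M)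
    {y : Plane} (hy : y ∈ φ.target) :
    mfderiv (𝓡 2) (𝓡 2) φ.symm y (coordField X φ y) = X (φ.symm y) :=
  mfderiv_symm_mfderiv hφ (φ.map_target hy) (φ.right_inv hy) _

variable [IsManifold (𝓡 2) ∞ M]

theorem coord_coordField (g : LorentzMetric M) (X : (x : M) → TangentSpace (𝓡 2) x)
    {φ : OpenPartialHomeomorph M Plane} (hφ : φ ∈ IsManifold.maximalAtlas (𝓡 2) ∞ M)
    {y : Plane} (hy : y ∈ φ.target) :
    g.coord φ y (coordField X φ y) (coordField X φ y) =
      g.val (φ.symm y) (X (φ.symm y)) (X (φ.symm y)) := by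
  rw [coord, mfderiv_symm_coordField X hφ hy]

theorem exists_coord_pos (g : LorentzMetric M) {φ : OpenPartialHomeomorph M Plane}
    (hφ : φ ∈ IsManifold.maximalAtlas (𝓡 2) ∞ M) {y : Plane} (hy : y ∈ φ.target) :
    ∃ v, 0 < g.coord φ y v v := by
  obtain ⟨w, hw⟩ := g.exists_timelike (φ.symm y)
  refine ⟨mfderiv (𝓡 2) (𝓡 2) φ (φ.symm y) w, ?_⟩
  have h : mfderiv (𝓡 2) (𝓡 2) φ.symm y (mfderiv (𝓡 2) (𝓡 2) φ (φ.symm y) w : Plane) = w :=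
    mfderiv_symm_mfderiv hφ (φ.map_target hy) (φ.right_inv hy) w
  exact hw.trans_eq (congrArg₂ (fun a b => g.val (φ.symm y) a b) h h).symm

/-- The components are the fibre part of the tangent map of `φ` composed with the smooth section `X`
and `φ.symm`. -/
theorem contDiffOn_coordField {X : (x : M) → TangentSpace (𝓡 2) x}
    (hX : ContMDiff (𝓡 2) (𝓡 2).tangent ∞ (fun x => (⟨x, X x⟩ : TangentBundle (𝓡 2) M)))
    {φ : OpenPartialHomeomorph M Plane} (hφ : φ ∈ IsManifold.maximalAtlas (𝓡 2) ∞ M) :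
    ContDiffOn ℝ ∞ (coordField X φ) φ.target := by
  have h1 := (contMDiffOn_of_mem_maximalAtlas hφ).contMDiffOn_tangentMapWithin (m := ∞)
    (by simp) φ.open_source.uniqueMDiffOn
  have h2 := h1.comp (hX.comp_contMDiffOn (contMDiffOn_symm_of_mem_maximalAtlas hφ))
    fun y hy => φ.map_target hy
  have h3 := (contMDiff_snd_tangentBundle_modelSpace Plane (𝓡 2)).comp_contMDiffOn h2
  refine (contMDiffOn_iff_contDiffOn.1 h3).congr fun y hy => ?_
  exact DFunLike.congr_fun (mfderivWithin_of_isOpen φ.open_source (φ.map_target hy)).symm _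

/-- A change of coordinates. -/
theorem exists_chart (g : LorentzMetric M) {φ : OpenPartialHomeomorph M Plane}
    (hφ : φ ∈ IsManifold.maximalAtlas (𝓡 2) ∞ M) {p : M} (hp : p ∈ φ.source) {W : Set Plane}
    (hW : IsOpen W) (hpW : φ p ∈ W) {Φ : Plane → Plane}
    (hΦ : ContDiffOn ℝ ∞ Φ W) (hinj : ∀ z ∈ W, Function.Injective (fderiv ℝ Φ z)) :
    ∃ φ' ∈ IsManifold.maximalAtlas (𝓡 2) ∞ M, p ∈ φ'.source ∧ ∀ y ∈ φ'.target,
      ∃ z ∈ W, Φ z = y ∧ ∀ a b, g.coord φ' y (fderiv ℝ Φ z a) (fderiv ℝ Φ z b) =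
        g.coord φ z a b := by
  have sΦ : ∀ z ∈ W, ContDiffAt ℝ ∞ Φ z := fun z hz => hΦ.contDiffAt (hW.mem_nhds hz)
  have dΦ : ∀ z ∈ W, ∃ L : Plane ≃L[ℝ] Plane, HasFDerivAt Φ (L : Plane →L[ℝ] Plane) z :=
    fun z hz => ⟨(LinearEquiv.ofInjectiveEndo (fderiv ℝ Φ z : Plane →ₗ[ℝ] Plane)
      (hinj z hz)).toContinuousLinearEquiv, ((sΦ z hz).differentiableAt (by simp)).hasFDerivAt⟩
  obtain ⟨L, hL⟩ := dΦ _ hpW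
  -- Inverse function theorem for `Φ` at `φ p`, with the source shrunk to `W` so that `Φ` stays
  -- smooth with invertible derivative and the inverse is smooth on all of `ψ.target`.
  obtain ⟨ψ, hψ, hpψ, hψW⟩ : ∃ ψ : OpenPartialHomeomorph Plane Plane,
      (ψ : Plane → Plane) = Φ ∧ φ p ∈ ψ.source ∧ ψ.source ⊆ W :=
    ⟨((sΦ _ hpW).toOpenPartialHomeomorph Φ hL (by simp)).restrOpen W hW, rfl,
      ⟨(sΦ _ hpW).mem_toOpenPartialHomeomorph_source hL (by simp), hpW⟩, fun _ h => h.2⟩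
  have hψs : ContDiffOn ℝ ∞ ψ.symm ψ.target := fun y hy => by
    have hz := hψW (ψ.map_target hy)
    obtain ⟨L', hL'⟩ := dΦ _ hz
    exact (ψ.contDiffAt_symm hy (hψ ▸ hL') (hψ ▸ sΦ _ hz)).contDiffWithinAt
  have hmem : φ.trans ψ ∈ IsManifold.maximalAtlas (𝓡 2) ∞ M := by
    refine (φ.trans ψ).mem_maximalAtlas_of_contMDiffOn ?_ ?_
    · refine (contMDiffOn_iff_contDiffOn.2 hΦ).comp' (contMDiffOn_of_mem_maximalAtlas hφ)
        |>.congr_mono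
        (fun x _ => by rw [OpenPartialHomeomorph.coe_trans, hψ]) fun x hx => ?_
      rw [OpenPartialHomeomorph.trans_source] at hx
      exact ⟨hx.1, hψW hx.2⟩
    · refine (contMDiffOn_symm_of_mem_maximalAtlas hφ).comp' (contMDiffOn_iff_contDiffOn.2 hψs)
        |>.congr_mono (fun x _ => rfl) fun x hx => ?_
      rw [OpenPartialHomeomorph.trans_target] at hx
      exact hx
  refine ⟨φ.trans ψ, hmem, ?_, fun y hy => ?_⟩
  · rw [OpenPartialHomeomorph.trans_source]
    exact ⟨hp, hpψ⟩
  have hy' := hy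
  rw [OpenPartialHomeomorph.trans_target] at hy'
  obtain ⟨z, hz, rfl⟩ : ∃ z ∈ ψ.source, Φ z = y :=
    ⟨ψ.symm y, ψ.map_target hy'.1, by rw [← hψ]; exact ψ.right_inv hy'.1⟩
  have hzW := hψW hz
  refine ⟨z, hzW, rfl, fun a b => ?_⟩
  have hx : (φ.trans ψ).symm (Φ z) = φ.symm z := by
    rw [← hψ, OpenPartialHomeomorph.coe_trans_symm, Function.comp_apply, ψ.left_inv hz]
  have he : (φ.trans ψ).symm ∘ Φ =ᶠ[nhds z] φ.symm := by
    filter_upwards [ψ.open_source.mem_nhds hz] with t ht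
    simp only [← hψ, OpenPartialHomeomorph.coe_trans_symm, Function.comp_apply, ψ.left_inv ht]
  have hd : ∀ a : Plane, (mfderiv (𝓡 2) (𝓡 2) (φ.trans ψ).symm (Φ z) (fderiv ℝ Φ z a) : Plane) =
      (mfderiv (𝓡 2) (𝓡 2) φ.symm z a : Plane) := fun a => by
    have hc := mfderiv_comp (I := 𝓡 2) (I' := 𝓡 2) (I'' := 𝓡 2) z
      ((mDifferentiable_of_mem_maximalAtlas hmem).mdifferentiableAt_symm hy)
      ((sΦ z hzW).differentiableAt (by simp)).mdifferentiableAt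
    rw [mfderiv_eq_fderiv] at hc
    have h1 := DFunLike.congr_fun hc a
    rw [← show (mfderiv (𝓡 2) (𝓡 2) ((φ.trans ψ).symm ∘ Φ) z a : Plane) =
      (mfderiv (𝓡 2) (𝓡 2) φ.symm z a : Plane) from by rw [he.mfderiv_eq]; rfl]
    exact h1.symm
  -- All tangent spaces are definitionally the model plane; forgetting their dependence on the point
  -- allows the base point to be rewritten.
  let G : M → Plane → Plane → ℝ := fun x v w => g.val x v w
  change G _ _ _ = G _ _ _
  rw [hx]
  exact congrArg₂ (G _) (hd a) (hd b)

end LorentzMetric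

/-- If the two covectors were dependent, `η₁² - η₂²` would be semidefinite and could not be negative
on `v` and positive on `w`. -/
theorem CartanFrame.det_ne_zero {U : Set Plane} (c : CartanFrame U) {y v w : Plane}
    (hv : c.η₁ y v ^ 2 < c.η₂ y v ^ 2) (hw : c.η₂ y w ^ 2 < c.η₁ y w ^ 2) : c.det y ≠ 0 := by
  intro h
  have e : c.η₁ y v * c.η₂ y w = c.η₁ y w * c.η₂ y v := by
    have hv' := plane_eq v
    have hw' := plane_eq w
    rw [hv', hw']
    simp only [map_add, map_smul, smul_eq_mul]
    rw [det] at h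
    linear_combination (v 0 * w 1 - v 1 * w 0) * h
  have e2 : c.η₁ y v ^ 2 * c.η₂ y w ^ 2 = c.η₁ y w ^ 2 * c.η₂ y v ^ 2 := by
    rw [← mul_pow, e, mul_pow]
  nlinarith [sq_nonneg (c.η₁ y v), sq_nonneg (c.η₂ y w)]

namespace LorentzMetric

variable {M : Type*} [TopologicalSpace M] [ChartedSpace Plane M] [IsManifold (𝓡 2) ∞ M]

theorem exists_chart_hasDiagonalForm (g : LorentzMetric M) {φ : OpenPartialHomeomorph M Plane}
    (hφ : φ ∈ IsManifold.maximalAtlas (𝓡 2) ∞ M) {p : M} (hp : p ∈ φ.source)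
    {c : CartanFrame φ.target} (hc : g.IsOrthonormal φ c) (hdet : ∀ y ∈ φ.target, c.det y ≠ 0)
    {W : Set Plane} (hW : IsOpen W) (hWφ : W ⊆ φ.target) (hpW : φ p ∈ W) {u v : Plane → ℝ}
    {A B : ℝ → ℝ} (su : ContDiffOn ℝ ∞ u W) (sv : ContDiffOn ℝ ∞ v W) (pu : ∀ y ∈ W, 0 < u y)
    (h : ∀ y ∈ W, ∀ a b, c.η₁ y a * c.η₁ y b - c.η₂ y a * c.η₂ y b =
        A (u y) * (fderiv ℝ u y a * fderiv ℝ u y b)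
          - B (u y) * (fderiv ℝ v y a * fderiv ℝ v y b)) :
    ∃ φ' ∈ IsManifold.maximalAtlas (𝓡 2) ∞ M, p ∈ φ'.source ∧ (∀ y ∈ φ'.target, 0 < y 0) ∧
      g.HasDiagonalForm φ' A B := by
  have sΦ : ContDiffOn ℝ ∞ (fun y => !₂[u y, v y]) W := by
    rw [contDiffOn_euclidean]
    intro i
    fin_cases i
    exacts [su, sv]
  have dΦ : ∀ z ∈ W, HasFDerivAt (fun y => !₂[u y, v y])
      (fderiv ℝ (fun y => !₂[u y, v y]) z) z := fun z hz =>
    ((sΦ.contDiffAt (hW.mem_nhds hz)).differentiableAt (by simp)).hasFDerivAt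
  have du : ∀ z ∈ W, ∀ a, fderiv ℝ u z a = fderiv ℝ (fun y => !₂[u y, v y]) z a 0 :=
    fun z hz => DFunLike.congr_fun
      (show HasFDerivAt u _ z from (coordCovector 0).hasFDerivAt.comp z (dΦ z hz)).fderiv
  have dv : ∀ z ∈ W, ∀ a, fderiv ℝ v z a = fderiv ℝ (fun y => !₂[u y, v y]) z a 1 :=
    fun z hz => DFunLike.congr_fun
      (show HasFDerivAt v _ z from (coordCovector 1).hasFDerivAt.comp z (dΦ z hz)).fderiv
  -- The metric is expressed through `du` and `dv`, so a vector killed by both lies in its radical,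
  -- which is zero.
  have hinj : ∀ z ∈ W, Function.Injective (fderiv ℝ (fun y => !₂[u y, v y]) z) := fun z hz => by
    refine (injective_iff_map_eq_zero _).2 fun a ha => ?_
    have hz' := hdet z (hWφ hz)
    have h0 : ∀ b, c.η₁ z a * c.η₁ z b - c.η₂ z a * c.η₂ z b = 0 := fun b => by
      rw [h z hz, du z hz, dv z hz, ha]
      simp
    refine c.eq_zero_of_coframe hz' ?_ ?_
    · simpa [c.η₁_vec _ _ hz', c.η₂_vec _ _ hz'] using h0 (c.vec 1 0 z)
    · simpa [c.η₁_vec _ _ hz', c.η₂_vec _ _ hz'] using h0 (c.vec 0 1 z)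
  obtain ⟨φ', hφ', hp', h'⟩ := g.exists_chart hφ hp hW hpW sΦ hinj
  refine ⟨φ', hφ', hp', fun y hy => ?_, fun y hy a b => ?_⟩
  · obtain ⟨z, hz, rfl, -⟩ := h' y hy
    exact pu z hz
  · obtain ⟨z, hz, rfl, hab⟩ := h' y hy
    have hsurj := LinearMap.injective_iff_surjective
      (f := (fderiv ℝ (fun y => !₂[u y, v y]) z : Plane →ₗ[ℝ] Plane)).1 (hinj z hz)
    obtain ⟨a, rfl⟩ := hsurj a
    obtain ⟨b, rfl⟩ := hsurj b
    refine (hab a b).trans ?_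
    rw [hc z (hWφ hz), h z hz, du z hz, du z hz, dv z hz, dv z hz]
    rfl

/-- Near every point, the metric is one of the models in suitable coordinates. -/
theorem exists_isModel (g : LorentzMetric M) (hg : g.IsEllipticDarbouxIntegrable)
    {X : (x : M) → TangentSpace (𝓡 2) x} (hX : g.IsKillingField X) (hXs : g.IsSpacelikeField X)
    (p : M) :
    ∃ φ ∈ IsManifold.maximalAtlas (𝓡 2) ∞ M, p ∈ φ.source ∧ (∀ y ∈ φ.target, 0 < y 0) ∧
      ∃ A B, KillingFrame.IsModel A B ∧ g.HasDiagonalForm φ A B := by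
  obtain ⟨φ, hφ, hp, c, hc, hcD⟩ := hg p
  have hs : ∀ y ∈ φ.target, c.η₁ y (coordField X φ y) ^ 2 < c.η₂ y (coordField X φ y) ^ 2 :=
    fun y hy => by
      have h1 := g.coord_coordField X hφ hy
      have h2 := hXs (φ.symm y)
      rw [← h1, hc y hy] at h2
      nlinarith
  have hdet : ∀ y ∈ φ.target, c.det y ≠ 0 := fun y hy => by
    obtain ⟨w, hw⟩ := g.exists_coord_pos hφ hy
    rw [hc y hy] at hw
    exact c.det_ne_zero (hs y hy) (by nlinarith)
  obtain ⟨k, -⟩ := c.exists_killingFrame φ.open_target hdet (contDiffOn_coordField hX.1 hφ)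
    (fun y hy a b => by
      have h := hX.2 φ hφ y hy a b
      have he : (fun z => g.coord φ z a b) =ᶠ[nhds y]
          fun z => c.η₁ z a * c.η₁ z b - c.η₂ z a * c.η₂ z b := by
        filter_upwards [φ.open_target.mem_nhds hy] with z hz using hc z hz a b
      rwa [he.fderiv_eq, hc y hy, hc y hy] at h) hs
  obtain ⟨W, hWφ, hW, hpW, u, v, A, B, hAB, su, sv, pu, h⟩ :=
    k.exists_coordinates φ.open_target hdet hcD (φ.map_source hp)
  obtain ⟨φ', h1, h2, h3, h4⟩ :=
    g.exists_chart_hasDiagonalForm hφ hp hc hdet hW hWφ hpW su sv pu h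
  exact ⟨φ', h1, h2, h3, A, B, hAB, h4⟩

end LorentzMetric
end IsoEmbed

theorem mainTheorem9 {M : Type*} [TopologicalSpace M] [ChartedSpace IsoEmbed.Plane M]
    [IsManifold (𝓡 2) ∞ M] (g : IsoEmbed.LorentzMetric M)
    (hg : g.IsEllipticDarbouxIntegrable)
    (X : (x : M) → TangentSpace (𝓡 2) x) (hX : g.IsKillingField X) (hXs : g.IsSpacelikeField X)
    (p : M) :
    ∃ φ ∈ IsManifold.maximalAtlas (𝓡 2) ∞ M, p ∈ φ.source ∧ (∀ y ∈ φ.target, 0 < y 0) ∧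
      ((∃ r : ℝ, 0 < r ∧
          g.HasDiagonalForm φ (fun u => r * Real.cosh u ^ 4) (fun u => r * Real.sinh u ^ 2) ∧
          g.HasGaussCurvature φ (fun y => 1 / (r * Real.cosh (y 0) ^ 4))) ∨
       (∃ r : ℝ, 0 < r ∧
          g.HasDiagonalForm φ (fun u => r * Real.sinh u ^ 4) (fun u => r * Real.cosh u ^ 2) ∧
          g.HasGaussCurvature φ (fun y => 1 / (r * Real.sinh (y 0) ^ 4))) ∨
       (g.HasDiagonalForm φ (fun u => u ^ 2) (fun u => u ^ 2) ∧
          g.HasGaussCurvature φ (fun y => 1 / y 0 ^ 4))) := by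
  obtain ⟨φ, hφ, hp, hpos, A, B, hAB, h⟩ := g.exists_isModel hg hX hXs p
  refine ⟨φ, hφ, hp, hpos, ?_⟩
  rcases hAB with ⟨r, hr, rfl, rfl⟩ | ⟨r, hr, rfl, rfl⟩ | ⟨rfl, rfl⟩
  · exact Or.inl ⟨r, hr, h, h.hasGaussCurvature_cosh hr hpos⟩
  · exact Or.inr (Or.inl ⟨r, hr, h, h.hasGaussCurvature_sinh hr hpos⟩)
  · exact Or.inr (Or.inr ⟨h, h.hasGaussCurvature_sq hpos⟩)
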